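/- Let $R=\bigoplus_{n\ge 0}R_n$ be a commutative Noetherian standard graded ring (that is, $R$ is generated by $R_1$ as an $R_0$-algebra) such that $R_0$ is local with maximal ideal $\mathfrak m_0$. Put $R_+=\bigoplus_{n\ge 1}R_n$, let $M,N$ be finitely generated $\mathbb Z$-graded $R$-modules, and let $\mathfrak a_0\subseteq\mathfrak m_0$ be an ideal of $R_0$. For a homogeneous ideal $\mathfrak b$ of $R$ and $i\ge 0$ let $$H^i_{\mathfrak b}(M,N)=\varinjlim_{k}\operatorname{Ext}^i_R(M/\mathfrak b^kM,N)$$ be the $i$-th generalized local cohomology module with its natural grading. Its $n$-th component is the $R_0$-module $$H^i_{\mathfrak b}(M,N)_n=\varinjlim_k \operatorname{Ext}^i_R(M/\mathfrak b^kM,N)_n,$$ where $\operatorname{Ext}^i_R(L,N)_n$, for a finitely generated graded module $L$, is the group $\operatorname{Ext}^i(L,N(n))$ formed in the category of graded $R$-modules and degree-zero homomorphisms, with $N(n)_m=N_{n+m}$. Let $$g_{\mathfrak b}(M,N)=\sup\{\,i\in\mathbb N_0 : \text{for all } j<i,\ \operatorname{length}_{R_0}H^j_{\mathfrak b}(M,N)_n<\infty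 \text{ for all } n\ll 0\,\}\in\mathbb N_0\cup\{\infty\}.$$ 1. Let $y\in R_1$. For every integer $i\ge 0$ with $i\le g_{yR}(M,N)$ there is $n_0\in\mathbb Z$ such that, for all $n\le n_0$, there is an isomorphism of $R_0$-modules $$H^i_{yR+\mathfrak a_0R}(M,N)_n\cong H^i_{yR+\mathfrak a_0R}(M,N)_{n_0}.$$ 2. Suppose that the ideal $R_+$ is principal and that $M$ has finite projective dimension over $R$. Then, for every integer $i\ge 0$ with $i\le g_{R_+}(M,N)$, there are only finitely many isomorphism classes of $R_0$-modules among the components $H^i_{\mathfrak a_0R+R_+}(M,N)_n$, $n\in\mathbb Z$. -/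

import Mathlib

universe u

section

open CategoryTheory CategoryTheory.Limits DirectSum

variable {R : Type u} [CommRing R]

/-- A `ℤ`-graded module over the `ℕ`-graded commutative ring `R = ⨁ 𝒜 n`. -/
structure GradedModuleCat (𝒜 : ℕ → AddSubgroup R) [GradedRing 𝒜] : Type (u + 1) where
  /-- the underlying `R`-module -/
  carrier : Type u
  [addCommGroup : AddCommGroup carrier]
  [module : Module R carrier]
  /-- the homogeneous components -/
  deg : ℤ → AddSubgroup carrier
  [decomposition : DirectSum.Decomposition deg]
  smul_mem : ∀ {i : ℕ} {j : ℤ} {r : R} {x : carrier},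
    r ∈ 𝒜 i → x ∈ deg j → r • x ∈ deg ((i : ℤ) + j)

namespace GradedModuleCat

variable {𝒜 : ℕ → AddSubgroup R} [GradedRing 𝒜]

attribute [instance] addCommGroup module decomposition

instance : CoeSort (GradedModuleCat 𝒜) (Type u) := ⟨carrier⟩

/-- A graded `R`-module is an `R₀`-module by restriction of scalars. -/
instance gradeZeroModule (X : GradedModuleCat 𝒜) : Module (𝒜 0) X :=
  Module.compHom X (algebraMap (𝒜 0) R)

theorem gradeZero_smul_def (X : GradedModuleCat 𝒜) (r : 𝒜 0) (x : X) : r • x = (r : R) • x := rfl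

instance (X : GradedModuleCat 𝒜) : SMulCommClass R (𝒜 0) X where
  smul_comm r s x := smul_comm r (s : R) x

theorem gradeZero_smul_mem (X : GradedModuleCat 𝒜) (r : 𝒜 0) {n : ℤ} {x : X} (hx : x ∈ X.deg n) :
    r • x ∈ X.deg n := by
  have h := X.smul_mem r.2 hx
  rwa [Nat.cast_zero, zero_add] at h

/-- The projection of a graded module to its `n`-th homogeneous component. -/
def proj (X : GradedModuleCat 𝒜) (n : ℤ) : X →+ X where
  toFun x := (decompose X.deg x n : X)
  map_zero' := by simp
  map_add' := by simp

theorem proj_apply (X : GradedModuleCat 𝒜) (n : ℤ) (x : X) :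
    X.proj n x = (decompose X.deg x n : X) := rfl

theorem proj_mem (X : GradedModuleCat 𝒜) (n : ℤ) (x : X) : X.proj n x ∈ X.deg n :=
  (decompose X.deg x n).2

theorem proj_same (X : GradedModuleCat 𝒜) {n : ℤ} {x : X} (hx : x ∈ X.deg n) : X.proj n x = x :=
  decompose_of_mem_same X.deg hx

theorem proj_ne (X : GradedModuleCat 𝒜) {m n : ℤ} {x : X} (hx : x ∈ X.deg m) (h : m ≠ n) :
    X.proj n x = 0 :=
  decompose_of_mem_ne X.deg hx h

open Classical in
theorem sum_proj (X : GradedModuleCat 𝒜) (x : X) :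
    ∑ n ∈ (decompose X.deg x).support, X.proj n x = x :=
  sum_support_decompose X.deg x

theorem mem_of_forall_proj_mem (X : GradedModuleCat 𝒜) {S : Type*} [SetLike S X]
    [AddSubmonoidClass S X] (T : S) {x : X} (h : ∀ n, X.proj n x ∈ T) : x ∈ T := by
  classical
  rw [← X.sum_proj x]
  exact sum_mem fun n _ => h n

/-- A criterion for a family of subgroups to be a grading. -/
noncomputable abbrev decompositionOfProj {M : Type u} [AddCommGroup M] (ℳ : ℤ → AddSubgroup M)
    (p : ℤ → M →+ M) (hsame : ∀ n, ∀ x ∈ ℳ n, p n x = x)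
    (hne : ∀ m n, m ≠ n → ∀ x ∈ ℳ m, p n x = 0)
    (hspan : ∀ T : AddSubgroup M, (∀ n, ℳ n ≤ T) → T = ⊤) : DirectSum.Decomposition ℳ := by
  classical
  refine DirectSum.IsInternal.chooseDecomposition ℳ ⟨?_, ?_⟩
  · have key : ∀ (n : ℤ) (z : ⨁ n, ℳ n), p n (DirectSum.coeAddMonoidHom ℳ z) = z n := by
      intro n z
      induction z using DirectSum.induction_on with
      | zero => simp
      | of m x =>
        rw [DirectSum.coeAddMonoidHom_of]
        by_cases h : m = n
        · subst h
          rw [DirectSum.of_eq_same, hsame _ _ x.2]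
        · rw [DirectSum.of_eq_of_ne _ _ _ (Ne.symm h), hne _ _ h _ x.2, AddSubgroup.coe_zero]
      | add x y hx hy => rw [map_add, map_add, hx, hy, DirectSum.add_apply, AddSubgroup.coe_add]
    intro z w hzw
    refine DFinsupp.ext fun n => Subtype.ext ?_
    rw [← key n z, ← key n w]
    exact congrArg (p n) hzw
  · have h := hspan (DirectSum.coeAddMonoidHom ℳ).range
      (fun n x hx => ⟨DirectSum.of (fun n => ℳ n) n ⟨x, hx⟩, DirectSum.coeAddMonoidHom_of ℳ n ⟨x, hx⟩⟩)
    intro x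
    have hx : x ∈ (DirectSum.coeAddMonoidHom ℳ).range := h ▸ AddSubgroup.mem_top x
    exact hx

/-! ### Morphisms -/

/-- Homomorphisms of graded modules: the `R`-linear maps of degree `0`. -/
def homSubmodule (X Y : GradedModuleCat 𝒜) : Submodule (𝒜 0) (X →ₗ[R] Y) where
  carrier := {f | ∀ (n : ℤ) (x : X), x ∈ X.deg n → f x ∈ Y.deg n}
  zero_mem' _ _ _ := zero_mem _
  add_mem' hf hg n x hx := add_mem (hf n x hx) (hg n x hx)
  smul_mem' r _ hf n x hx := Y.gradeZero_smul_mem r (hf n x hx)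

instance : Category (GradedModuleCat 𝒜) where
  Hom X Y := homSubmodule X Y
  id X := ⟨LinearMap.id, fun _ _ hx => hx⟩
  comp f g := ⟨g.1 ∘ₗ f.1, fun n _ hx => g.2 n _ (f.2 n _ hx)⟩

/-- The underlying `R`-linear map of a morphism. -/
def Hom.lin {X Y : GradedModuleCat 𝒜} (f : X ⟶ Y) : X →ₗ[R] Y := f.1

/-- The morphism defined by an `R`-linear map of degree `0`. -/
def ofLin {X Y : GradedModuleCat 𝒜} (f : X →ₗ[R] Y) (hf : ∀ n, ∀ x ∈ X.deg n, f x ∈ Y.deg n) :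
    X ⟶ Y := ⟨f, hf⟩

theorem lin_mem {X Y : GradedModuleCat 𝒜} (f : X ⟶ Y) {n : ℤ} {x : X} (hx : x ∈ X.deg n) :
    Hom.lin f x ∈ Y.deg n := f.2 n x hx

theorem hom_ext {X Y : GradedModuleCat 𝒜} {f g : X ⟶ Y} (h : ∀ x, Hom.lin f x = Hom.lin g x) :
    f = g := Subtype.ext (LinearMap.ext h)

@[simp] theorem lin_ofLin {X Y : GradedModuleCat 𝒜} (f : X →ₗ[R] Y)
    (hf : ∀ n, ∀ x ∈ X.deg n, f x ∈ Y.deg n) : Hom.lin (ofLin f hf) = f := rfl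

@[simp] theorem lin_id (X : GradedModuleCat 𝒜) : Hom.lin (𝟙 X) = LinearMap.id := rfl

@[simp] theorem lin_comp {X Y Z : GradedModuleCat 𝒜} (f : X ⟶ Y) (g : Y ⟶ Z) :
    Hom.lin (f ≫ g) = Hom.lin g ∘ₗ Hom.lin f := rfl

instance (X Y : GradedModuleCat 𝒜) : AddCommGroup (X ⟶ Y) :=
  inferInstanceAs (AddCommGroup (homSubmodule X Y))

instance (X Y : GradedModuleCat 𝒜) : Module (𝒜 0) (X ⟶ Y) :=
  inferInstanceAs (Module (𝒜 0) (homSubmodule X Y))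

@[simp] theorem lin_zero (X Y : GradedModuleCat 𝒜) : Hom.lin (0 : X ⟶ Y) = 0 := rfl

@[simp] theorem lin_add {X Y : GradedModuleCat 𝒜} (f g : X ⟶ Y) :
    Hom.lin (f + g) = Hom.lin f + Hom.lin g := rfl

@[simp] theorem lin_smul {X Y : GradedModuleCat 𝒜} (r : 𝒜 0) (f : X ⟶ Y) :
    Hom.lin (r • f) = r • Hom.lin f := rfl

instance : Preadditive (GradedModuleCat 𝒜) where
  add_comp _ _ _ _ _ _ := hom_ext fun _ => by simp
  comp_add _ _ _ _ _ _ := hom_ext fun _ => by simp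

instance : Linear (𝒜 0) (GradedModuleCat 𝒜) where
  smul_comp _ _ _ _ _ g := hom_ext fun _ => (Hom.lin g).map_smul _ _
  comp_smul _ _ _ _ _ _ := hom_ext fun _ => rfl

theorem lin_proj {X Y : GradedModuleCat 𝒜} (f : X ⟶ Y) (n : ℤ) (x : X) :
    Hom.lin f (X.proj n x) = Y.proj n (Hom.lin f x) := by
  classical
  induction x using DirectSum.Decomposition.inductionOn X.deg with
  | zero => simp
  | @homogeneous m x =>
    by_cases h : m = n
    · subst h
      rw [X.proj_same x.2, Y.proj_same (lin_mem f x.2)]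
    · rw [X.proj_ne x.2 h, Y.proj_ne (lin_mem f x.2) h, map_zero]
  | add x y hx hy => simp only [map_add, hx, hy]

/-! ### Submodules, quotients, products and shifts -/

/-- A homogeneous submodule as a graded module. -/
noncomputable def sub (X : GradedModuleCat 𝒜) (S : Submodule R X) (hS : S.IsHomogeneous X.deg) :
    GradedModuleCat 𝒜 where
  carrier := S
  deg n := (X.deg n).comap S.subtype.toAddMonoidHom
  decomposition := decompositionOfProj _
    (fun n => ((X.proj n).comp S.subtype.toAddMonoidHom).codRestrict S fun x => hS n x.2)
    (fun _ _ hx => Subtype.ext (X.proj_same hx))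
    (fun _ _ h _ hx => Subtype.ext (X.proj_ne hx h))
    (fun T hT => by
      refine eq_top_iff.2 fun x _ => ?_
      have h : (x : X) ∈ T.map S.subtype.toAddMonoidHom :=
        X.mem_of_forall_proj_mem _ fun n =>
          ⟨⟨X.proj n x, hS n x.2⟩, hT n (X.proj_mem n x), rfl⟩
      obtain ⟨y, hy, hyx⟩ := h
      rwa [← Subtype.ext (show (y : X) = x from hyx)])
  smul_mem hr hx := X.smul_mem hr hx

/-- The quotient of a graded module by a homogeneous submodule; its `n`-th component is the image
of the `n`-th component. -/
noncomputable def quot (X : GradedModuleCat 𝒜) (S : Submodule R X) (hS : S.IsHomogeneous X.deg) :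
    GradedModuleCat 𝒜 where
  carrier := X ⧸ S
  deg n := (X.deg n).map S.mkQ.toAddMonoidHom
  decomposition := decompositionOfProj _
    (fun n => QuotientAddGroup.lift S.toAddSubgroup (S.mkQ.toAddMonoidHom.comp (X.proj n))
      fun x hx => (Submodule.Quotient.mk_eq_zero S).2 (hS n hx))
    (by
      rintro n _ ⟨x, hx, rfl⟩
      exact congrArg S.mkQ (X.proj_same hx))
    (by
      rintro m n h _ ⟨x, hx, rfl⟩
      exact (congrArg S.mkQ (X.proj_ne hx h)).trans (map_zero _))
    (fun T hT => by
      refine eq_top_iff.2 fun x _ => ?_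
      obtain ⟨x, rfl⟩ := S.mkQ_surjective x
      exact X.mem_of_forall_proj_mem (T.comap S.mkQ.toAddMonoidHom) fun n =>
        hT n ⟨_, X.proj_mem n x, rfl⟩)
  smul_mem := by
    rintro i j r _ hr ⟨x, hx, rfl⟩
    exact ⟨r • x, X.smul_mem hr hx, map_smul S.mkQ r x⟩

/-- The direct sum of two graded modules. -/
noncomputable def prod (X Y : GradedModuleCat 𝒜) : GradedModuleCat 𝒜 where
  carrier := X × Y
  deg n := (X.deg n).prod (Y.deg n)
  decomposition := decompositionOfProj _ (fun n => (X.proj n).prodMap (Y.proj n))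
    (fun _ _ hx => Prod.ext (X.proj_same hx.1) (Y.proj_same hx.2))
    (fun _ _ h _ hx => Prod.ext (X.proj_ne hx.1 h) (Y.proj_ne hx.2 h))
    (fun T hT => by
      refine eq_top_iff.2 fun x _ => ?_
      have h1 : x.1 ∈ T.comap (AddMonoidHom.inl X Y) :=
        X.mem_of_forall_proj_mem _ fun n => hT n ⟨X.proj_mem n x.1, zero_mem _⟩
      have h2 : x.2 ∈ T.comap (AddMonoidHom.inr X Y) :=
        Y.mem_of_forall_proj_mem _ fun n => hT n ⟨zero_mem _, Y.proj_mem n x.2⟩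
      have h : x = (x.1, 0) + (0, x.2) := by simp
      rw [h]
      exact T.add_mem h1 h2)
  smul_mem hr hx := ⟨X.smul_mem hr hx.1, Y.smul_mem hr hx.2⟩

/-- The zero graded module. -/
noncomputable def zero (𝒜 : ℕ → AddSubgroup R) [GradedRing 𝒜] : GradedModuleCat 𝒜 where
  carrier := PUnit
  deg _ := ⊤
  decomposition := decompositionOfProj _ (fun _ => 0) (fun _ _ _ => rfl) (fun _ _ _ _ _ => rfl)
    (fun _ hT => eq_top_iff.2 (hT 0))
  smul_mem _ _ := AddSubgroup.mem_top _

/-- The shift `X(d)`, with `X(d)ₙ = Xₙ₊d`. -/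
noncomputable def shift (X : GradedModuleCat 𝒜) (d : ℤ) : GradedModuleCat 𝒜 where
  carrier := X
  deg n := X.deg (n + d)
  decomposition := decompositionOfProj _ (fun n => X.proj (n + d))
    (fun _ _ hx => X.proj_same hx)
    (fun _ _ h _ hx => X.proj_ne hx (fun e => h (add_right_cancel e)))
    (fun T hT => eq_top_iff.2 fun x _ => X.mem_of_forall_proj_mem T fun n =>
      hT (n - d) (by simpa using X.proj_mem n x))
  smul_mem {i j _ _} hr hx := by
    rw [add_assoc]
    exact X.smul_mem hr hx

/-! ### The category of graded modules is abelian -/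

/-- An injective morphism onto the kernel of `f` is a kernel of `f`. -/
noncomputable def isLimitOfInjective {K X Y : GradedModuleCat 𝒜} (i : K ⟶ X) (f : X ⟶ Y)
    (w : i ≫ f = 0) (hi : Function.Injective (Hom.lin i))
    (hr : ∀ x, Hom.lin f x = 0 → ∃ k, Hom.lin i k = x) : IsLimit (KernelFork.ofι i w) := by
  have hr' : LinearMap.ker (Hom.lin f) ≤ LinearMap.range (Hom.lin i) := fun x hx => hr x hx
  have key : ∀ {A : GradedModuleCat 𝒜} (k : A ⟶ X) (_ : k ≫ f = 0) (a : A),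
      Hom.lin k a ∈ LinearMap.range (Hom.lin i) := fun k hk a => hr' (by
    have h := congrArg (fun g => Hom.lin g a) hk
    simpa using h)
  let l : ∀ {A : GradedModuleCat 𝒜} (k : A ⟶ X) (_ : k ≫ f = 0), A →ₗ[R] K := fun k hk =>
    (LinearEquiv.ofInjective (Hom.lin i) hi).symm.toLinearMap ∘ₗ
      (Hom.lin k).codRestrict _ (key k hk)
  have hl : ∀ {A : GradedModuleCat 𝒜} (k : A ⟶ X) (hk : k ≫ f = 0) (a : A),
      Hom.lin i (l k hk a) = Hom.lin k a := fun k hk a => by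
    have h := LinearEquiv.ofInjective_symm_apply (f := Hom.lin i) (h := hi)
      ((Hom.lin k).codRestrict _ (key k hk) a)
    exact h
  refine KernelFork.IsLimit.ofι i w (fun k hk => ofLin (l k hk) fun n a ha => ?_)
    (fun k hk => hom_ext fun a => ?_) (fun k hk m hm => hom_ext fun a => ?_)
  · have h : K.proj n (l k hk a) = l k hk a := hi (by
      rw [lin_proj, hl k hk, proj_same _ (lin_mem k ha)])
    rw [← h]
    exact K.proj_mem n _
  · exact hl k hk a
  · apply hi
    rw [lin_ofLin, hl k hk, ← hm]
    rfl

/-- A surjective morphism whose kernel is the image of `f` is a cokernel of `f`. -/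
noncomputable def isColimitOfSurjective {X Y Q : GradedModuleCat 𝒜} (f : X ⟶ Y) (p : Y ⟶ Q)
    (w : f ≫ p = 0) (hp : Function.Surjective (Hom.lin p))
    (hk : ∀ y, Hom.lin p y = 0 → ∃ x, Hom.lin f x = y) : IsColimit (CokernelCofork.ofπ p w) := by
  have key : ∀ {A : GradedModuleCat 𝒜} (k : Y ⟶ A) (_ : f ≫ k = 0),
      LinearMap.ker (Hom.lin p) ≤ LinearMap.ker (Hom.lin k) := fun k hk' y hy => by
    obtain ⟨x, rfl⟩ := hk y hy
    have h := congrArg (fun g => Hom.lin g x) hk'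
    simpa using h
  let l : ∀ {A : GradedModuleCat 𝒜} (k : Y ⟶ A) (_ : f ≫ k = 0), Q →ₗ[R] A := fun k hk' =>
    (LinearMap.ker (Hom.lin p)).liftQ (Hom.lin k) (key k hk') ∘ₗ
      ((Hom.lin p).quotKerEquivOfSurjective hp).symm.toLinearMap
  have hl : ∀ {A : GradedModuleCat 𝒜} (k : Y ⟶ A) (hk' : f ≫ k = 0) (y : Y),
      l k hk' (Hom.lin p y) = Hom.lin k y := fun k hk' y => by
    have h : ((Hom.lin p).quotKerEquivOfSurjective hp).symm (Hom.lin p y) =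
        Submodule.Quotient.mk y := by
      rw [LinearEquiv.symm_apply_eq]
      rfl
    change (LinearMap.ker (Hom.lin p)).liftQ (Hom.lin k) (key k hk')
      (((Hom.lin p).quotKerEquivOfSurjective hp).symm (Hom.lin p y)) = _
    rw [h]
    rfl
  refine CokernelCofork.IsColimit.ofπ p w (fun k hk' => ofLin (l k hk') fun n q hq => ?_)
    (fun k hk' => hom_ext fun y => ?_) (fun k hk' m hm => hom_ext fun q => ?_)
  · obtain ⟨y, rfl⟩ := hp q
    rw [← Q.proj_same hq, ← lin_proj, hl k hk']
    exact lin_mem k (Y.proj_mem n y)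
  · exact hl k hk' y
  · obtain ⟨y, rfl⟩ := hp q
    rw [lin_ofLin, hl k hk', ← hm]
    rfl

theorem ker_isHomogeneous {X Y : GradedModuleCat 𝒜} (f : X ⟶ Y) :
    (LinearMap.ker (Hom.lin f)).IsHomogeneous X.deg := fun n x hx => by
  have h := lin_proj f n x
  rw [LinearMap.mem_ker.1 hx, map_zero] at h
  exact h

theorem range_isHomogeneous {X Y : GradedModuleCat 𝒜} (f : X ⟶ Y) :
    (LinearMap.range (Hom.lin f)).IsHomogeneous Y.deg := by
  rintro n _ ⟨x, rfl⟩
  exact ⟨_, lin_proj f n x⟩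

instance : HasZeroObject (GradedModuleCat 𝒜) where
  zero := ⟨zero 𝒜,
    fun _ => ⟨⟨⟨0⟩, fun _ => hom_ext fun x => by
      rw [show x = 0 from Subsingleton.elim (α := PUnit) _ _, map_zero, map_zero]⟩⟩,
    fun _ => ⟨⟨⟨0⟩, fun _ => hom_ext fun _ => Subsingleton.elim (α := PUnit) _ _⟩⟩⟩

instance : HasBinaryBiproducts (GradedModuleCat 𝒜) where
  has_binary_biproduct X Y := HasBinaryBiproduct.mk
    { bicone :=
        { pt := X.prod Y
          fst := ofLin (Y := X) (LinearMap.fst R X Y) fun _ _ hx => hx.1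
          snd := ofLin (Y := Y) (LinearMap.snd R X Y) fun _ _ hx => hx.2
          inl := ofLin (X := X) (LinearMap.inl R X Y) fun _ _ hx => ⟨hx, zero_mem _⟩
          inr := ofLin (X := Y) (LinearMap.inr R X Y) fun _ _ hx => ⟨zero_mem _, hx⟩
          inl_fst := rfl
          inl_snd := rfl
          inr_fst := rfl
          inr_snd := rfl }
      isBilimit := isBinaryBilimitOfTotal _ (hom_ext fun x =>
        Prod.ext (add_zero (x : X × Y).1) (zero_add (x : X × Y).2)) }

instance : HasFiniteProducts (GradedModuleCat 𝒜) := hasFiniteProducts_of_has_binary_and_terminal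

/-- Kernel, cokernel and image of a homomorphism of graded modules. -/
theorem nonempty_abelianStruct {X Y : GradedModuleCat 𝒜} (f : X ⟶ Y) :
    Nonempty (Abelian.AbelianStruct f) := by
  let K := X.sub _ (ker_isHomogeneous f)
  let Q := Y.quot _ (range_isHomogeneous f)
  let I := Y.sub _ (range_isHomogeneous f)
  let i : K ⟶ X := ofLin (X := K) (LinearMap.ker (Hom.lin f)).subtype fun _ _ hx => hx
  let p : Y ⟶ Q := ofLin (Y := Q) (LinearMap.range (Hom.lin f)).mkQ fun _ x hx => ⟨x, hx, rfl⟩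
  let π : X ⟶ I := ofLin (Y := I) (Hom.lin f).rangeRestrict fun _ _ hx => lin_mem f hx
  let ι : I ⟶ Y := ofLin (X := I) (LinearMap.range (Hom.lin f)).subtype fun _ _ hx => hx
  have hif : i ≫ f = 0 := hom_ext fun x => x.2
  have hfp : f ≫ p = 0 := hom_ext fun x => (Submodule.Quotient.mk_eq_zero _).2 ⟨x, rfl⟩
  have hiπ : i ≫ π = 0 := hom_ext fun x => Subtype.ext x.2
  have hιp : ι ≫ p = 0 := hom_ext fun x => (Submodule.Quotient.mk_eq_zero _).2 x.2
  exact ⟨{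
    kernelFork := KernelFork.ofι i hif
    isLimitKernelFork := isLimitOfInjective i f hif Subtype.val_injective
      fun x hx => ⟨⟨x, hx⟩, rfl⟩
    cokernelCofork := CokernelCofork.ofπ p hfp
    isColimitCokernelCofork := isColimitOfSurjective f p hfp (Submodule.mkQ_surjective _)
      fun y hy => (Submodule.Quotient.mk_eq_zero _).1 hy
    image := I
    imageπ := π
    ι_imageπ := hiπ
    imageIsCokernel := isColimitOfSurjective i π hiπ (Hom.lin f).surjective_rangeRestrict
      fun x hx => ⟨⟨x, congrArg Subtype.val hx⟩, rfl⟩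
    imageι := ι
    imageι_π := hιp
    imageIsKernel := isLimitOfInjective ι p hιp Subtype.val_injective
      fun y hy => ⟨⟨y, (Submodule.Quotient.mk_eq_zero _).1 hy⟩, rfl⟩
    fac := rfl }⟩

noncomputable instance : Abelian (GradedModuleCat 𝒜) :=
  Abelian.mk' fun _ _ f => nonempty_abelianStruct f

instance : HasExt.{u + 1} (GradedModuleCat 𝒜) := HasExt.standard _

/-! ### Generalized local cohomology -/

theorem smul_top_isHomogeneous (I : Ideal R) (hI : I.IsHomogeneous 𝒜) (X : GradedModuleCat 𝒜) :
    (I • (⊤ : Submodule R X)).IsHomogeneous X.deg := by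
  classical
  intro n x hx
  change X.proj n x ∈ _
  induction hx using Submodule.smul_induction_on' with
  | smul r hr x _ =>
    rw [← DirectSum.sum_support_decompose 𝒜 r, ← X.sum_proj x, Finset.sum_smul, map_sum]
    refine sum_mem fun i _ => ?_
    rw [Finset.smul_sum, map_sum]
    refine sum_mem fun j _ => ?_
    have hmem := X.smul_mem (decompose 𝒜 r i).2 (X.proj_mem j x)
    by_cases h : (i : ℤ) + j = n
    · rw [X.proj_same (h ▸ hmem)]
      exact Submodule.smul_mem_smul (hI i hr) trivial
    · rw [X.proj_ne hmem h]
      exact zero_mem _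
  | add x _ y _ hx hy =>
    rw [map_add]
    exact add_mem hx hy

theorem pow_isHomogeneous (b : HomogeneousIdeal 𝒜) (k : ℕ) : (b.toIdeal ^ k).IsHomogeneous 𝒜 := by
  induction k with
  | zero =>
    rw [pow_zero, Ideal.one_eq_top]
    exact Ideal.IsHomogeneous.top 𝒜
  | succ k ih =>
    rw [pow_succ]
    exact ih.mul b.isHomogeneous

/-- The graded module `M / bᵏ M`. -/
noncomputable def quotPow (b : HomogeneousIdeal 𝒜) (M : GradedModuleCat 𝒜) (k : ℕ) :
    GradedModuleCat 𝒜 :=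
  M.quot (b.toIdeal ^ k • (⊤ : Submodule R M)) (smul_top_isHomogeneous _ (pow_isHomogeneous b k) M)

/-- The canonical projection `M / bˡ M → M / bᵏ M` for `k ≤ l`. -/
noncomputable def quotPowMap (b : HomogeneousIdeal 𝒜) (M : GradedModuleCat 𝒜) {k l : ℕ}
    (h : k ≤ l) : quotPow b M l ⟶ quotPow b M k :=
  ofLin (X := quotPow b M l) (Y := quotPow b M k)
    (Submodule.factor (Submodule.smul_mono_left (Ideal.pow_le_pow_right h))) (by
      rintro n _ ⟨x, hx, rfl⟩
      exact ⟨x, hx, rfl⟩)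

/-- The `n`-th homogeneous component of the graded module `Ext^i_R(L, N)`, as an `R₀`-module: the
group `Ext^i(L, N(n))` in the category of graded `R`-modules. For `R` Noetherian and `L` finitely
generated, `Ext^i_R(L, N)` is the direct sum of these groups over `n ∈ ℤ`, and this is its natural
grading. -/
abbrev ExtDeg (i : ℕ) (L N : GradedModuleCat 𝒜) (n : ℤ) : Type (u + 1) :=
  Abelian.Ext L (N.shift n) i

/-- The maps `Ext^i_R(M / bᵏ M, N)ₙ → Ext^i_R(M / bˡ M, N)ₙ`, for `k ≤ l`, induced by the canonical
projections. -/
noncomputable def extTransition (b : HomogeneousIdeal 𝒜) (i : ℕ) (M N : GradedModuleCat 𝒜) (n : ℤ)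
    (k l : ℕ) (h : k ≤ l) :
    ExtDeg i (quotPow b M k) N n →ₗ[𝒜 0] ExtDeg i (quotPow b M l) N n :=
  (Abelian.Ext.mk₀ (quotPowMap b M h)).precompOfLinear (𝒜 0) (N.shift n) (zero_add i)

/-- The `n`-th homogeneous component, as an `R₀`-module, of the `i`-th generalized local cohomology
module `H^i_b(M, N) = colim_k Ext^i_R(M / bᵏ M, N)` of the graded modules `M` and `N` with respect
to the homogeneous ideal `b`. -/
abbrev LocalCohomologyDeg (b : HomogeneousIdeal 𝒜) (i : ℕ) (M N : GradedModuleCat 𝒜) (n : ℤ) :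
    Type (u + 1) :=
  Module.DirectLimit (fun k => ExtDeg i (quotPow b M k) N n) (extTransition b i M N n)

/-- The cohomological finite length dimension `g_b(M, N)`: the supremum of the `i` such that, for
all `j < i`, the `R₀`-module `H^j_b(M, N)ₙ` has finite length for all `n ≪ 0`. -/
noncomputable def finiteLengthDim (b : HomogeneousIdeal 𝒜) (M N : GradedModuleCat 𝒜) : ℕ∞ :=
  ⨆ i ∈ {i : ℕ | ∀ j < i, ∀ᶠ n : ℤ in Filter.atBot,
    Module.length (𝒜 0) (LocalCohomologyDeg b j M N n) < ⊤}, (i : ℕ∞)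

end GradedModuleCat

/-- The homogeneous ideal `yR` generated by an element `y` of degree one. -/
def HomogeneousIdeal.spanDegOne (𝒜 : ℕ → AddSubgroup R) [GradedRing 𝒜] (y : R) (hy : y ∈ 𝒜 1) :
    HomogeneousIdeal 𝒜 where
  toSubmodule := Ideal.span {y}
  is_homogeneous' := Ideal.homogeneous_span 𝒜 {y} (by
    rintro x rfl
    exact ⟨1, hy⟩)

/-- The homogeneous ideal `a₀R` generated by an ideal `a₀` of `R₀`. -/
def HomogeneousIdeal.extendGradeZero (𝒜 : ℕ → AddSubgroup R) [GradedRing 𝒜] (a₀ : Ideal (𝒜 0)) :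
    HomogeneousIdeal 𝒜 where
  toSubmodule := a₀.map (algebraMap (𝒜 0) R)
  is_homogeneous' := Ideal.homogeneous_span 𝒜 _ (by
    rintro _ ⟨x, _, rfl⟩
    exact ⟨0, x.2⟩)

end

/-!
Multiplication by `y ∈ R₁` induces isomorphisms `H^i_b(M, N)ₙ ≅ H^i_b(M, N)ₙ₊₁`, for
`b = a₀R + yR`, in all sufficiently small degrees `n`, and, when `R₊ = yR`, also in all sufficiently
large degrees. Only the finitely many components in between can then contribute further
isomorphism classes.

Multiplication by `y` on `N` factors as `N(n) → (yN)(n + 1) → N(n + 1)`, with kernel `(0 :_N y)(n)`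
and cokernel `(N / yN)(n + 1)`. By the long exact `Ext` sequences and the exactness of the colimit
over `k`, it suffices that the cohomology of these two modules, which are killed by `y`, vanishes
in the degrees considered (`nonempty_localCohomologyDeg_equiv`).

In large degrees, when `R₊ = yR`, a finitely generated module killed by `y` lives in finitely many
degrees, and dimension shifting along graded free covers gives the vanishing of
`Ext^i(M / bᵏ M, -)ₙ` uniformly in `k` (`ext_eq_zero_of_ge`).

In small degrees, two facts are combined.

* If a homogeneous element `x` kills `N`, the vanishing of `H^i_b(M, N)` implies that of
  `H^i_{b+xR}(M, N)` (`ColimExtVanishes.sup_of_smul_eq_zero`). For `P = M / bˡ M` the inclusions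
  `xʲ⁺¹ P → xʲ P` are eventually multiplication by `x` up to an isomorphism, because `P` is
  Noetherian, and multiplication by `x` induces zero on `Ext(-, N)`.
* `H^i_{a₀R}(M, N)ₙ = 0` for `n ≪ 0` (`vanishesAtBot_extendGradeZero`), by induction on the number
  of generators of `a₀`. For the zero ideal this is the vanishing of `Ext^i(M, N)ₙ`. When a
  generator `x ∈ R₀` is added to `b`, the first fact and the induction hypothesis show that `x` acts
  injectively on `H^i_{b+xR}(M, N)ₙ` for `n ≪ 0`; since this module is `x`-torsion, it is zero.
-/

namespace GradedModuleCat

open CategoryTheory CategoryTheory.Limits DirectSum Abelian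

variable {R : Type u} [CommRing R] {𝒜 : ℕ → AddSubgroup R}

/-! ### Morphisms, shifts and short exact sequences -/

variable (𝒜) in
/-- The components of the `ℕ`-graded ring `R`, indexed by `ℤ`. -/
def degInt (n : ℤ) : AddSubgroup R := if 0 ≤ n then 𝒜 n.toNat else ⊥

theorem degInt_natCast (n : ℕ) : degInt 𝒜 n = 𝒜 n := by simp [degInt]

theorem degInt_of_neg {n : ℤ} (hn : n < 0) : degInt 𝒜 n = ⊥ := by simp [degInt, hn]

variable [GradedRing 𝒜]

theorem mono_of_injective {X Y : GradedModuleCat 𝒜} (f : X ⟶ Y)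
    (hf : Function.Injective (Hom.lin f)) : Mono f where
  right_cancellation g h w := hom_ext fun x => hf <| by
    simpa using congrArg (fun k => Hom.lin k x) w

theorem epi_of_surjective {X Y : GradedModuleCat 𝒜} (f : X ⟶ Y)
    (hf : Function.Surjective (Hom.lin f)) : Epi f where
  left_cancellation g h w := hom_ext fun y => by
    obtain ⟨x, rfl⟩ := hf y
    simpa using congrArg (fun k => Hom.lin k x) w

theorem surjective_of_epi {X Y : GradedModuleCat 𝒜} (f : X ⟶ Y) [Epi f] :
    Function.Surjective (Hom.lin f) := by
  let p : Y ⟶ Y.quot _ (range_isHomogeneous f) :=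
    ofLin (Y := Y.quot _ (range_isHomogeneous f)) (LinearMap.range (Hom.lin f)).mkQ
      fun _ x hx => ⟨x, hx, rfl⟩
  have hfp : f ≫ p = f ≫ 0 := by
    rw [comp_zero]
    exact hom_ext fun x => (Submodule.Quotient.mk_eq_zero _).2 ⟨x, rfl⟩
  intro y
  exact (Submodule.Quotient.mk_eq_zero _).1
    (congrArg (fun k => Hom.lin k y) ((cancel_epi f).1 hfp))

theorem isIso_of_bijective {X Y : GradedModuleCat 𝒜} (f : X ⟶ Y)
    (hf : Function.Bijective (Hom.lin f)) : IsIso f := by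
  have := mono_of_injective f hf.1
  have := epi_of_surjective f hf.2
  exact isIso_of_mono_of_epi f

theorem shortExact_of_lin {X Y Z : GradedModuleCat 𝒜} (f : X ⟶ Y) (g : Y ⟶ Z) (w : f ≫ g = 0)
    (hf : Function.Injective (Hom.lin f)) (hg : Function.Surjective (Hom.lin g))
    (h : ∀ y, Hom.lin g y = 0 → ∃ x, Hom.lin f x = y) :
    (ShortComplex.mk f g w).ShortExact where
  exact := ShortComplex.exact_of_f_is_kernel _ (isLimitOfInjective f g w hf h)
  mono_f := mono_of_injective f hf
  epi_g := epi_of_surjective g hg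

/-- The inclusion of a homogeneous submodule. -/
noncomputable def subι (X : GradedModuleCat 𝒜) (S : Submodule R X) (hS : S.IsHomogeneous X.deg) :
    X.sub S hS ⟶ X :=
  ofLin (X := X.sub S hS) S.subtype fun _ _ hx => hx

/-- The projection onto the quotient by a homogeneous submodule. -/
noncomputable def quotπ (X : GradedModuleCat 𝒜) (S : Submodule R X) (hS : S.IsHomogeneous X.deg) :
    X ⟶ X.quot S hS :=
  ofLin (Y := X.quot S hS) S.mkQ fun _ x hx => ⟨x, hx, rfl⟩

theorem subι_injective (X : GradedModuleCat 𝒜) (S : Submodule R X) (hS : S.IsHomogeneous X.deg) :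
    Function.Injective (Hom.lin (X.subι S hS)) := Subtype.val_injective

theorem quotπ_surjective (X : GradedModuleCat 𝒜) (S : Submodule R X)
    (hS : S.IsHomogeneous X.deg) : Function.Surjective (Hom.lin (X.quotπ S hS)) :=
  S.mkQ_surjective

theorem subι_quotπ (X : GradedModuleCat 𝒜) (S : Submodule R X) (hS : S.IsHomogeneous X.deg) :
    X.subι S hS ≫ X.quotπ S hS = 0 :=
  hom_ext fun x => (Submodule.Quotient.mk_eq_zero _).2 x.2

theorem shortExact_sub_quot (X : GradedModuleCat 𝒜) (S : Submodule R X)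
    (hS : S.IsHomogeneous X.deg) :
    (ShortComplex.mk _ _ (X.subι_quotπ S hS)).ShortExact :=
  shortExact_of_lin _ _ _ (X.subι_injective S hS) (X.quotπ_surjective S hS)
    fun y hy => ⟨⟨y, (Submodule.Quotient.mk_eq_zero _).1 hy⟩, rfl⟩

/-- The kernel of a morphism, as a graded module. -/
noncomputable abbrev ker {X Y : GradedModuleCat 𝒜} (f : X ⟶ Y) : GradedModuleCat 𝒜 :=
  X.sub _ (ker_isHomogeneous f)

/-- The inclusion of the kernel of a morphism. -/
noncomputable abbrev kerι {X Y : GradedModuleCat 𝒜} (f : X ⟶ Y) : ker f ⟶ X :=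
  X.subι _ (ker_isHomogeneous f)

theorem kerι_comp {X Y : GradedModuleCat 𝒜} (f : X ⟶ Y) : kerι f ≫ f = 0 :=
  hom_ext fun x => x.2

theorem shortExact_ker {X Y : GradedModuleCat 𝒜} (f : X ⟶ Y)
    (hf : Function.Surjective (Hom.lin f)) :
    (ShortComplex.mk _ _ (kerι_comp f)).ShortExact :=
  shortExact_of_lin _ _ _ (X.subι_injective _ _) hf fun y hy => ⟨⟨y, hy⟩, rfl⟩

/-- The shift of a morphism. -/
noncomputable def shiftMap {X Y : GradedModuleCat 𝒜} (f : X ⟶ Y) (d : ℤ) :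
    X.shift d ⟶ Y.shift d :=
  ofLin (X := X.shift d) (Y := Y.shift d) (Hom.lin (X := X) (Y := Y) f) fun _ _ hx =>
    lin_mem (X := X) (Y := Y) f hx

theorem shiftMap_comp_eq_zero {X Y Z : GradedModuleCat 𝒜} {f : X ⟶ Y} {g : Y ⟶ Z}
    (w : f ≫ g = 0) (d : ℤ) : shiftMap f d ≫ shiftMap g d = 0 :=
  hom_ext fun x => congrArg (fun k : X ⟶ Z => Hom.lin k x) w

theorem shiftMap_surjective {X Y : GradedModuleCat 𝒜} {f : X ⟶ Y}
    (hf : Function.Surjective (Hom.lin f)) (d : ℤ) :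
    Function.Surjective (Hom.lin (shiftMap f d)) := hf

/-- Shifting preserves short exactness of `0 ⟶ ker f ⟶ X ⟶ Y ⟶ 0`. -/
theorem shortExact_ker_shift {X Y : GradedModuleCat 𝒜} (f : X ⟶ Y)
    (hf : Function.Surjective (Hom.lin f)) (d : ℤ) :
    (ShortComplex.mk _ _ (shiftMap_comp_eq_zero (kerι_comp f) d)).ShortExact :=
  shortExact_of_lin _ _ _ (X.subι_injective _ (ker_isHomogeneous f)) (shiftMap_surjective hf d)
    fun y hy => ⟨(⟨y, hy⟩ : LinearMap.ker (Hom.lin f)), rfl⟩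

/-- Shifting preserves short exactness of `0 ⟶ S ⟶ X ⟶ X / S ⟶ 0`. -/
theorem shortExact_sub_quot_shift (X : GradedModuleCat 𝒜) (S : Submodule R X)
    (hS : S.IsHomogeneous X.deg) (d : ℤ) :
    (ShortComplex.mk _ _ (shiftMap_comp_eq_zero (X.subι_quotπ S hS) d)).ShortExact :=
  shortExact_of_lin _ _ _ (X.subι_injective S hS)
    (shiftMap_surjective (X.quotπ_surjective S hS) d)
    fun y hy => ⟨(⟨y, (Submodule.Quotient.mk_eq_zero _).1 hy⟩ : S), rfl⟩

instance projective_shift (X : GradedModuleCat 𝒜) [Projective X] (d : ℤ) :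
    Projective (X.shift d) where
  factors {E B} f e _ := by
    have hd : ∀ n : ℤ, n + d + -d = n := fun n => by ring
    have hd' : ∀ n : ℤ, n + -d + d = n := fun n => by ring
    let f' : X ⟶ B.shift (-d) :=
      ofLin (X := X) (Y := B.shift (-d)) (Hom.lin (X := X.shift d) (Y := B) f) fun n x hx =>
      lin_mem (X := X.shift d) (Y := B) f (n := n + -d) (x := x) (by
        change x ∈ X.deg (n + -d + d)
        rwa [hd'])
    have : Epi (shiftMap e (-d)) :=
      epi_of_surjective _ (shiftMap_surjective (surjective_of_epi e) (-d))
    let s := Projective.factorThru f' (shiftMap e (-d))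
    have hs : s ≫ shiftMap e (-d) = f' := Projective.factorThru_comp _ _
    refine ⟨ofLin (X := X.shift d) (Y := E) (Hom.lin (X := X) (Y := E.shift (-d)) s)
      fun n x hx => ?_, hom_ext fun x => ?_⟩
    · have h := lin_mem (X := X) (Y := E.shift (-d)) s hx
      change _ ∈ E.deg (n + d + -d) at h
      rwa [hd] at h
    · exact congrArg (fun k : X ⟶ B.shift (-d) => Hom.lin k x) hs

/-! ### Graded free modules -/

theorem smul_mem_of_degInt (X : GradedModuleCat 𝒜) {m n : ℤ} {r : R} {x : X}
    (hr : r ∈ degInt 𝒜 m) (hx : x ∈ X.deg n) : r • x ∈ X.deg (m + n) := by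
  rcases lt_or_ge m 0 with hm | hm
  · rw [degInt_of_neg hm, AddSubgroup.mem_bot] at hr
    simp [hr]
  · lift m to ℕ using hm
    exact X.smul_mem (degInt_natCast (𝒜 := 𝒜) m ▸ hr) hx

variable (𝒜) in
/-- The graded ring `R` as a graded module over itself. -/
noncomputable def regular : GradedModuleCat 𝒜 where
  carrier := R
  deg := degInt 𝒜
  decomposition := decompositionOfProj _
    (fun n => if 0 ≤ n then GradedRing.proj 𝒜 n.toNat else 0)
    (fun n x hx => by
      rcases lt_or_ge n 0 with hn | hn
      · rw [degInt_of_neg hn, AddSubgroup.mem_bot] at hx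
        simp [hx]
      · lift n to ℕ using hn
        rw [degInt_natCast] at hx
        simpa using decompose_of_mem_same 𝒜 hx)
    (fun m n h x hx => by
      rcases lt_or_ge m 0 with hm | hm
      · rw [degInt_of_neg hm, AddSubgroup.mem_bot] at hx
        simp [hx]
      · rcases lt_or_ge n 0 with hn | hn
        · rw [if_neg (not_le.2 hn), AddMonoidHom.zero_apply]
        · lift n to ℕ using hn
          lift m to ℕ using hm
          rw [degInt_natCast] at hx
          simpa using decompose_of_mem_ne 𝒜 hx (fun e => h (congrArg _ e)))
    (fun T hT => by
      classical
      refine eq_top_iff.2 fun x _ => ?_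
      rw [← sum_support_decompose 𝒜 x]
      exact sum_mem fun n _ => hT n (by
        rw [degInt_natCast]
        exact (decompose 𝒜 x n).2))
  smul_mem {i j r x} hr hx := by
    rcases lt_or_ge j 0 with hj | hj
    · rw [degInt_of_neg hj, AddSubgroup.mem_bot] at hx
      simp [hx]
    · lift j to ℕ using hj
      rw [degInt_natCast] at hx
      have h : r * x ∈ degInt 𝒜 ((i + j : ℕ) : ℤ) := by
        rw [degInt_natCast]
        exact SetLike.GradedMul.mul_mem hr hx
      rwa [Nat.cast_add] at h

/-- The product of a finite family of graded modules. -/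
noncomputable def pi {ι : Type u} [Finite ι] (X : ι → GradedModuleCat 𝒜) : GradedModuleCat 𝒜 where
  carrier := ∀ i, X i
  deg n := AddSubgroup.pi Set.univ fun i => (X i).deg n
  decomposition := decompositionOfProj _
    (fun n => AddMonoidHom.mk' (fun x i => (X i).proj n (x i)) fun x y => by ext; simp)
    (fun n x hx => funext fun i => (X i).proj_same (hx i trivial))
    (fun m n h x hx => funext fun i => (X i).proj_ne (hx i trivial) h)
    (fun T hT => by
      classical
      have := Fintype.ofFinite ι
      refine eq_top_iff.2 fun x _ => ?_
      rw [← Finset.univ_sum_single x]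
      refine sum_mem fun i _ => ?_
      refine (X i).mem_of_forall_proj_mem (T.comap (AddMonoidHom.single (fun i => X i) i))
        fun n => hT n fun j _ => ?_
      rcases eq_or_ne j i with rfl | hj
      · simpa using (X j).proj_mem n (x j)
      · simp [hj])
  smul_mem hr hx i hi := (X i).smul_mem hr (hx i hi)

variable (𝒜) in
/-- The graded free module with a basis of elements of degrees `d i`. -/
noncomputable abbrev free {ι : Type u} [Finite ι] (d : ι → ℤ) : GradedModuleCat 𝒜 :=
  pi fun i => (regular 𝒜).shift (-d i)

/-- The underlying module of a graded free module. -/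
noncomputable def freeEquiv {ι : Type u} [Finite ι] (d : ι → ℤ) : (ι → R) ≃ₗ[R] free 𝒜 d :=
  LinearEquiv.refl R (ι → R)

theorem freeEquiv_mem_deg {ι : Type u} [Finite ι] {d : ι → ℤ} {n : ℤ} {x : ι → R} :
    freeEquiv (𝒜 := 𝒜) d x ∈ (free 𝒜 d).deg n ↔ ∀ i, x i ∈ degInt 𝒜 (n - d i) :=
  ⟨fun h i => h i trivial, fun h i _ => h i⟩

theorem freeEquiv_single_mem {ι : Type u} [Finite ι] [DecidableEq ι] (d : ι → ℤ) (i : ι) :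
    freeEquiv (𝒜 := 𝒜) d (Pi.single i 1) ∈ (free 𝒜 d).deg (d i) := by
  rw [freeEquiv_mem_deg]
  intro j
  rcases eq_or_ne j i with rfl | hj
  · have h1 : (1 : R) ∈ degInt 𝒜 ((0 : ℕ) : ℤ) := by
      rw [degInt_natCast]
      exact SetLike.GradedOne.one_mem
    simpa using h1
  · rw [Pi.single_eq_of_ne hj]
    exact zero_mem _

instance {ι : Type u} [Finite ι] (d : ι → ℤ) : Module.Finite R (free 𝒜 d) :=
  Module.Finite.equiv (freeEquiv (𝒜 := 𝒜) d)

/-- The morphism from a graded free module that takes given values on the basis. -/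
noncomputable def freeDesc {ι : Type u} [Fintype ι] (d : ι → ℤ) (X : GradedModuleCat 𝒜)
    (v : ι → X) (hv : ∀ i, v i ∈ X.deg (d i)) : free 𝒜 d ⟶ X :=
  ofLin (X := free 𝒜 d) (Fintype.linearCombination R v ∘ₗ (freeEquiv d).symm.toLinearMap) <| by
    intro n x hx
    obtain ⟨x, rfl⟩ := (freeEquiv d).surjective x
    rw [freeEquiv_mem_deg] at hx
    rw [LinearMap.comp_apply, LinearEquiv.coe_coe, LinearEquiv.symm_apply_apply,
      Fintype.linearCombination_apply]
    refine sum_mem fun i _ => ?_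
    have h := smul_mem_of_degInt X (hx i) (hv i)
    rwa [sub_add_cancel] at h

theorem lin_freeDesc {ι : Type u} [Fintype ι] (d : ι → ℤ) (X : GradedModuleCat 𝒜)
    (v : ι → X) (hv : ∀ i, v i ∈ X.deg (d i)) (x : ι → R) :
    Hom.lin (freeDesc d X v hv) (freeEquiv d x) = Fintype.linearCombination R v x := rfl

theorem free_hom_ext {ι : Type u} [Finite ι] [DecidableEq ι] {d : ι → ℤ}
    {X : GradedModuleCat 𝒜} {f g : free 𝒜 d ⟶ X}
    (h : ∀ i, Hom.lin f (freeEquiv d (Pi.single i 1)) = Hom.lin g (freeEquiv d (Pi.single i 1))) :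
    f = g := by
  have key : Hom.lin f ∘ₗ (freeEquiv d).toLinearMap = Hom.lin g ∘ₗ (freeEquiv d).toLinearMap :=
    LinearMap.pi_ext' fun i => LinearMap.ext_ring (h i)
  refine hom_ext fun x => ?_
  obtain ⟨x, rfl⟩ := (freeEquiv d).surjective x
  exact LinearMap.congr_fun key x

instance {ι : Type u} [Finite ι] (d : ι → ℤ) : Projective (free 𝒜 d) where
  factors {E B} f e _ := by
    classical
    have := Fintype.ofFinite ι
    choose v hv using fun i => surjective_of_epi e (Hom.lin f (freeEquiv d (Pi.single i 1)))
    refine ⟨freeDesc d E (fun i => E.proj (d i) (v i)) fun i => E.proj_mem _ _,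
      free_hom_ext fun i => ?_⟩
    rw [lin_comp, LinearMap.comp_apply, lin_freeDesc, Fintype.linearCombination_apply_single,
      one_smul, lin_proj, hv, proj_same _ (lin_mem f (freeEquiv_single_mem d i))]

/-- A finitely generated graded module `X` is a quotient of a graded free module of finite rank,
whose basis lives in degrees in which `X` is nonzero. -/
theorem exists_free_cover (X : GradedModuleCat 𝒜) [Module.Finite R X] :
    ∃ (ι : Type u) (_ : Finite ι) (d : ι → ℤ) (p : free 𝒜 d ⟶ X),
      Function.Surjective (Hom.lin p) ∧ ∀ i, X.deg (d i) ≠ ⊥ := by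
  classical
  obtain ⟨s, hs⟩ := Module.Finite.fg_top (R := R) (M := X)
  let t : Finset (X × ℤ) := s.biUnion fun x => (decompose X.deg x).support.image fun n => (x, n)
  have ht : ∀ x n, (x, n) ∈ t ↔ x ∈ s ∧ decompose X.deg x n ≠ 0 := fun x n => by
    simp [t]
  refine ⟨t, inferInstance, fun i => i.1.2,
    freeDesc (ι := t) _ X (fun i => X.proj i.1.2 i.1.1) fun i => X.proj_mem _ _, ?_, ?_⟩
  · rw [← LinearMap.range_eq_top, eq_top_iff, ← hs, Submodule.span_le]
    intro x hx
    refine X.mem_of_forall_proj_mem (LinearMap.range _) fun n => ?_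
    by_cases h : decompose X.deg x n = 0
    · rw [proj_apply, h]
      exact zero_mem _
    · refine ⟨freeEquiv _ (Pi.single ⟨(x, n), (ht x n).2 ⟨hx, h⟩⟩ 1), ?_⟩
      rw [lin_freeDesc, Fintype.linearCombination_apply_single, one_smul]
  · rintro ⟨⟨x, n⟩, h⟩ hbot
    exact ((ht x n).1 h).2 (Subtype.ext
      ((AddSubgroup.eq_bot_iff_forall _).1 hbot _ (decompose X.deg x n).2))

theorem exists_mem_deg_of_surjective {X Y : GradedModuleCat 𝒜} (f : X ⟶ Y)
    (hf : Function.Surjective (Hom.lin f)) {n : ℤ} {y : Y} (hy : y ∈ Y.deg n) :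
    ∃ x ∈ X.deg n, Hom.lin f x = y := by
  obtain ⟨x, rfl⟩ := hf y
  exact ⟨_, X.proj_mem n x, by rw [lin_proj, proj_same _ hy]⟩

theorem free_deg_eq_bot {ι : Type u} [Finite ι] {d : ι → ℤ} {n : ℤ} (hn : ∀ i, n < d i) :
    (free 𝒜 d).deg n = ⊥ := by
  refine (AddSubgroup.eq_bot_iff_forall _).2 fun x hx => ?_
  obtain ⟨x, rfl⟩ := (freeEquiv d).surjective x
  rw [freeEquiv_mem_deg] at hx
  rw [LinearEquiv.map_eq_zero_iff]
  ext i
  have h := hx i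
  rwa [degInt_of_neg (by linarith [hn i]), AddSubgroup.mem_bot] at h

theorem deg_eq_bot_of_surjective {X Y : GradedModuleCat 𝒜} (f : X ⟶ Y)
    (hf : Function.Surjective (Hom.lin f)) {n : ℤ} (h : X.deg n = ⊥) : Y.deg n = ⊥ := by
  refine (AddSubgroup.eq_bot_iff_forall _).2 fun y hy => ?_
  obtain ⟨x, hx, rfl⟩ := exists_mem_deg_of_surjective f hf hy
  rw [h, AddSubgroup.mem_bot] at hx
  rw [hx, map_zero]

theorem deg_eq_bot_of_injective {X Y : GradedModuleCat 𝒜} (f : X ⟶ Y)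
    (hf : Function.Injective (Hom.lin f)) {n : ℤ} (h : Y.deg n = ⊥) : X.deg n = ⊥ := by
  refine (AddSubgroup.eq_bot_iff_forall _).2 fun x hx => hf ?_
  rw [map_zero]
  exact (AddSubgroup.eq_bot_iff_forall _).1 h _ (lin_mem f hx)

theorem exists_forall_deg_eq_bot_of_lt (X : GradedModuleCat 𝒜) [Module.Finite R X] :
    ∃ c : ℤ, ∀ n < c, X.deg n = ⊥ := by
  obtain ⟨ι, _, d, p, hp, -⟩ := X.exists_free_cover
  obtain ⟨c, hc⟩ := (Set.finite_range d).bddBelow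
  exact ⟨c, fun n hn => deg_eq_bot_of_surjective p hp
    (free_deg_eq_bot fun i => hn.trans_le (hc ⟨i, rfl⟩))⟩

/-- If the irrelevant ideal is generated by an element that kills the finitely generated graded
module `X`, then `X` vanishes in all sufficiently large degrees. -/
theorem exists_forall_deg_eq_bot_of_gt (X : GradedModuleCat 𝒜) [Module.Finite R X] {y : R}
    (hirr : (HomogeneousIdeal.irrelevant 𝒜).toIdeal = Ideal.span {y})
    (hy : ∀ x : X, y • x = 0) : ∃ c : ℤ, ∀ n > c, X.deg n = ⊥ := by
  obtain ⟨ι, _, d, p, hp, -⟩ := X.exists_free_cover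
  obtain ⟨c, hc⟩ := (Set.finite_range d).bddAbove
  refine ⟨c, fun n hn => (AddSubgroup.eq_bot_iff_forall _).2 fun x hx => ?_⟩
  obtain ⟨z, hz, rfl⟩ := exists_mem_deg_of_surjective p hp hx
  obtain ⟨z, rfl⟩ := (freeEquiv d).surjective z
  rw [freeEquiv_mem_deg] at hz
  have key : ∀ i, ∃ r : R, y * r = z i := fun i => by
    have h := hz i
    have hpos : 0 < n - d i := by linarith [hc ⟨i, rfl⟩]
    obtain ⟨m, hm⟩ := Int.eq_ofNat_of_zero_le hpos.le
    rw [hm] at h hpos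
    rw [degInt_natCast] at h
    have h' := HomogeneousIdeal.mem_irrelevant_of_mem 𝒜 (by exact_mod_cast hpos) h
    obtain ⟨r, hr⟩ := Ideal.mem_span_singleton'.1 (hirr.le h')
    exact ⟨r, by rw [mul_comm, hr]⟩
  choose r hr using key
  have hz' : z = y • r := funext fun i => (hr i).symm
  rw [hz', map_smul, map_smul, hy]

/-! ### Vanishing of `Ext` by dimension shifting -/

/-- Dimension shifting along a short exact sequence whose middle term is projective. -/
theorem exists_extClass_comp {S : ShortComplex (GradedModuleCat 𝒜)} (hS : S.ShortExact)
    [Projective S.X₂] {Y : GradedModuleCat 𝒜} {i : ℕ} (ξ : Ext S.X₃ Y (i + 1)) :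
    ∃ η : Ext S.X₁ Y i, hS.extClass.comp η (add_comm 1 i) = ξ :=
  Ext.contravariant_sequence_exact₃ hS Y ξ (Ext.eq_zero_of_projective _) (add_comm 1 i)

/-- The connecting maps of the contravariant long exact `Ext` sequence are natural. -/
theorem mk₀_comp_extClass_comp {S₁ S₂ : ShortComplex (GradedModuleCat 𝒜)} (h₁ : S₁.ShortExact)
    (h₂ : S₂.ShortExact) (φ : S₁ ⟶ S₂) {Y : GradedModuleCat 𝒜} {i : ℕ} (η : Ext S₂.X₁ Y i) :
    (Ext.mk₀ φ.τ₃).comp (h₂.extClass.comp η (add_comm 1 i)) (zero_add (i + 1)) =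
      h₁.extClass.comp ((Ext.mk₀ φ.τ₁).comp η (zero_add i)) (add_comm 1 i) := by
  rw [← Ext.comp_assoc _ _ _ (zero_add 1) (add_comm 1 i) (by lia),
    ← ShortComplex.ShortExact.extClass_naturality h₁ h₂ φ, Ext.comp_assoc_of_second_deg_zero]

instance finite_sub [IsNoetherianRing R] (X : GradedModuleCat 𝒜) [Module.Finite R X]
    (S : Submodule R X) (hS : S.IsHomogeneous X.deg) : Module.Finite R (X.sub S hS) :=
  inferInstanceAs (Module.Finite R S)

instance finite_quot (X : GradedModuleCat 𝒜) [Module.Finite R X]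
    (S : Submodule R X) (hS : S.IsHomogeneous X.deg) : Module.Finite R (X.quot S hS) :=
  inferInstanceAs (Module.Finite R (X ⧸ S))

/-- For finitely generated graded modules, `Ext^i(L, N)ₙ` vanishes for `n ≪ 0`. -/
theorem ext_eq_zero_of_le [IsNoetherianRing R] (N : GradedModuleCat 𝒜) [Module.Finite R N]
    (i : ℕ) (L : GradedModuleCat 𝒜) [Module.Finite R L] :
    ∃ n₀ : ℤ, ∀ n ≤ n₀, ∀ ξ : Ext L (N.shift n) i, ξ = 0 := by
  obtain ⟨c, hc⟩ := N.exists_forall_deg_eq_bot_of_lt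
  induction i generalizing L with
  | zero =>
    classical
    obtain ⟨ι, _, d, p, hp, -⟩ := L.exists_free_cover
    obtain ⟨b, hb⟩ := (Set.finite_range d).bddAbove
    refine ⟨c - b - 1, fun n hn ξ => ?_⟩
    obtain ⟨f, rfl⟩ := Ext.addEquiv₀.symm.surjective ξ
    have := epi_of_surjective p hp
    have hf : f = 0 := by
      rw [← cancel_epi p, comp_zero]
      refine free_hom_ext fun i => ?_
      have h := lin_mem (p ≫ f) (freeEquiv_single_mem d i)
      change _ ∈ N.deg (d i + n) at h
      rw [hc _ (by linarith [hb ⟨i, rfl⟩])] at h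
      exact h
    rw [hf, map_zero]
  | succ i ih =>
    obtain ⟨ι, _, d, p, hp, -⟩ := L.exists_free_cover
    obtain ⟨n₀, h₀⟩ := ih (ker p)
    refine ⟨n₀, fun n hn ξ => ?_⟩
    obtain ⟨η, rfl⟩ := exists_extClass_comp (shortExact_ker p hp) ξ
    rw [h₀ n hn η, Ext.comp_zero]

/-- `Ext^i(L, N)ₙ` vanishes for all `i` if `L` lives in degrees `≥ c` and `N` in degrees
`< n + c`. -/
theorem ext_eq_zero_of_ge [IsNoetherianRing R] (N : GradedModuleCat 𝒜) {n c : ℤ}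
    (hN : ∀ m, n + c ≤ m → N.deg m = ⊥) (i : ℕ) (L : GradedModuleCat 𝒜) [Module.Finite R L]
    (hL : ∀ m < c, L.deg m = ⊥) (ξ : Ext L (N.shift n) i) : ξ = 0 := by
  induction i generalizing L with
  | zero =>
    obtain ⟨f, rfl⟩ := Ext.addEquiv₀.symm.surjective ξ
    have hf : f = 0 := hom_ext fun x => by
      refine (N.shift n).mem_of_forall_proj_mem (⊥ : AddSubgroup (N.shift n)) fun m => ?_
      rw [← lin_proj]
      have hx := L.proj_mem m x
      rcases lt_or_ge m c with hm | hm
      · rw [hL m hm, AddSubgroup.mem_bot] at hx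
        rw [hx, map_zero]
        exact zero_mem _
      · have h := lin_mem f hx
        change _ ∈ N.deg (m + n) at h
        rw [hN _ (by linarith)] at h
        exact h
    rw [hf, map_zero]
  | succ i ih =>
    obtain ⟨ι, _, d, p, hp, hd⟩ := L.exists_free_cover
    obtain ⟨η, rfl⟩ := exists_extClass_comp (shortExact_ker p hp) ξ
    have hd' : ∀ i, c ≤ d i := fun i => not_lt.1 fun h => hd i (hL _ h)
    rw [ih (ker p) (fun m hm => ?_) η, Ext.comp_zero]
    exact deg_eq_bot_of_injective (kerι p) (subι_injective _ _ _)
      (free_deg_eq_bot fun i => hm.trans_le (hd' i))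

/-! ### Multiplication by a homogeneous element -/

/-- Multiplication by a homogeneous element `x` of degree `e`, as a morphism `X ⟶ X(e)`. -/
noncomputable def smulHom {e : ℕ} {x : R} (hx : x ∈ 𝒜 e) (X : GradedModuleCat 𝒜) :
    X ⟶ X.shift e :=
  ofLin (X := X) (Y := X.shift e) (LinearMap.lsmul R X x) fun n z hz => by
    have h := X.smul_mem hx hz
    rw [add_comm] at h
    exact h

theorem smulHom_naturality {e : ℕ} {x : R} (hx : x ∈ 𝒜 e) {X Y : GradedModuleCat 𝒜}
    (f : X ⟶ Y) : f ≫ smulHom hx Y = smulHom hx X ≫ shiftMap f e :=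
  hom_ext fun z => ((Hom.lin f).map_smul x z).symm

/-- If `x` kills `N`, then multiplication by `x` on the first argument induces zero on
`Ext(-, N)`. -/
theorem smulHom_comp_eq_zero [IsNoetherianRing R] {e : ℕ} {x : R} (hx : x ∈ 𝒜 e)
    {N : GradedModuleCat 𝒜} (hN : ∀ z : N, x • z = 0) (i : ℕ) (L : GradedModuleCat 𝒜)
    [Module.Finite R L] (ξ : Ext (L.shift e) N i) :
    (Ext.mk₀ (smulHom hx L)).comp ξ (zero_add i) = 0 := by
  induction i generalizing L with
  | zero =>
    obtain ⟨f, rfl⟩ := Ext.addEquiv₀.symm.surjective ξ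
    rw [Ext.addEquiv₀_symm_apply, Ext.mk₀_comp_mk₀, Ext.mk₀_eq_zero_iff]
    exact hom_ext fun z =>
      ((Hom.lin (X := L.shift e) (Y := N) f).map_smul x z).trans (hN _)
  | succ i ih =>
    obtain ⟨ι, _, d, p, hp, -⟩ := L.exists_free_cover
    have h₁ := shortExact_ker p hp
    have h₂ := shortExact_ker_shift p hp e
    obtain ⟨η, rfl⟩ := exists_extClass_comp h₂ ξ
    let φ : ShortComplex.mk _ _ (kerι_comp p) ⟶
        ShortComplex.mk _ _ (shiftMap_comp_eq_zero (kerι_comp p) e) :=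
      { τ₁ := smulHom hx _
        τ₂ := smulHom hx _
        τ₃ := smulHom hx _
        comm₁₂ := (smulHom_naturality hx _).symm
        comm₂₃ := (smulHom_naturality hx _).symm }
    refine (mk₀_comp_extClass_comp h₁ h₂ φ η).trans ?_
    change h₁.extClass.comp ((Ext.mk₀ (smulHom hx (ker p))).comp η _) _ = 0
    rw [ih, Ext.comp_zero]

/-! ### The modules `M / bᵏ M` -/

/-- The projection `M ⟶ M / bᵏ M`. -/
noncomputable abbrev quotPowπ (b : HomogeneousIdeal 𝒜) (M : GradedModuleCat 𝒜) (k : ℕ) :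
    M ⟶ quotPow b M k :=
  M.quotπ _ (smul_top_isHomogeneous _ (pow_isHomogeneous b k) M)

theorem quotPowπ_surjective (b : HomogeneousIdeal 𝒜) (M : GradedModuleCat 𝒜) (k : ℕ) :
    Function.Surjective (Hom.lin (quotPowπ b M k)) := quotπ_surjective _ _ _

instance (b : HomogeneousIdeal 𝒜) (M : GradedModuleCat 𝒜) (k : ℕ) : Epi (quotPowπ b M k) :=
  epi_of_surjective _ (quotPowπ_surjective b M k)

instance (b : HomogeneousIdeal 𝒜) (M : GradedModuleCat 𝒜) [Module.Finite R M] (k : ℕ) :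
    Module.Finite R (quotPow b M k) :=
  finite_quot _ _ _

theorem quotPowπ_comp_quotPowMap (b : HomogeneousIdeal 𝒜) (M : GradedModuleCat 𝒜) {k l : ℕ}
    (h : k ≤ l) : quotPowπ b M l ≫ quotPowMap b M h = quotPowπ b M k := rfl

theorem quotPowMap_comp (b : HomogeneousIdeal 𝒜) (M : GradedModuleCat 𝒜) {j k l : ℕ}
    (h : j ≤ k) (h' : k ≤ l) :
    quotPowMap b M h' ≫ quotPowMap b M h = quotPowMap b M (h.trans h') := by
  rw [← cancel_epi (quotPowπ b M l), ← Category.assoc, quotPowπ_comp_quotPowMap,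
    quotPowπ_comp_quotPowMap, quotPowπ_comp_quotPowMap]

/-- The morphism out of `M / bᵏ M` induced by a morphism to a module killed by `bᵏ`. -/
noncomputable def quotPowDesc (b : HomogeneousIdeal 𝒜) {M Y : GradedModuleCat 𝒜} (k : ℕ)
    (f : M ⟶ Y) (h : b.toIdeal ^ k ≤ Module.annihilator R Y) : quotPow b M k ⟶ Y :=
  ofLin (X := quotPow b M k)
    (Submodule.liftQ _ (Hom.lin f) (Submodule.smul_le.2 fun r hr m _ => by
      rw [LinearMap.mem_ker, map_smul]
      exact Module.mem_annihilator.1 (h hr) _)) (by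
    rintro n _ ⟨x, hx, rfl⟩
    exact lin_mem f hx)

theorem quotPowπ_comp_quotPowDesc (b : HomogeneousIdeal 𝒜) {M Y : GradedModuleCat 𝒜}
    (k : ℕ) (f : M ⟶ Y) (h : b.toIdeal ^ k ≤ Module.annihilator R Y) :
    quotPowπ b M k ≫ quotPowDesc b k f h = f := rfl

theorem annihilator_le_of_surjective {X Y : GradedModuleCat 𝒜} (f : X ⟶ Y)
    (hf : Function.Surjective (Hom.lin f)) :
    Module.annihilator R X ≤ Module.annihilator R Y :=
  LinearMap.annihilator_le_of_surjective _ hf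

theorem pow_le_annihilator_quotPow (b : HomogeneousIdeal 𝒜) (M : GradedModuleCat 𝒜) (k : ℕ) :
    b.toIdeal ^ k ≤ Module.annihilator R (quotPow b M k) := fun r hr => by
  refine Module.mem_annihilator.2 fun z => ?_
  obtain ⟨m, rfl⟩ := quotPowπ_surjective b M k z
  rw [← map_smul]
  exact (Submodule.Quotient.mk_eq_zero _).2 (Submodule.smul_mem_smul hr trivial)

/-- The restriction map `Ext^i(M / bᵏ M, X) → Ext^i(M / bˡ M, X)`. -/
noncomputable def restrict (b : HomogeneousIdeal 𝒜) {i : ℕ} {M X : GradedModuleCat 𝒜} {k l : ℕ}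
    (h : k ≤ l) (ξ : Ext (quotPow b M k) X i) : Ext (quotPow b M l) X i :=
  (Ext.mk₀ (quotPowMap b M h)).comp ξ (zero_add i)

theorem restrict_restrict (b : HomogeneousIdeal 𝒜) {i : ℕ} {M X : GradedModuleCat 𝒜} {j k l : ℕ}
    (h : j ≤ k) (h' : k ≤ l) (ξ : Ext (quotPow b M j) X i) :
    restrict b h' (restrict b h ξ) = restrict b (h.trans h') ξ := by
  rw [restrict, restrict, Ext.mk₀_comp_mk₀_assoc, quotPowMap_comp, restrict]

theorem restrict_comp (b : HomogeneousIdeal 𝒜) {i j m : ℕ} {M X Y : GradedModuleCat 𝒜} {k l : ℕ}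
    (h : k ≤ l) (ξ : Ext (quotPow b M k) X i) (ζ : Ext X Y j) (hm : i + j = m) :
    restrict b h (ξ.comp ζ hm) = (restrict b h ξ).comp ζ hm :=
  (Ext.comp_assoc _ _ _ (zero_add i) hm (by lia)).symm

theorem restrict_zero (b : HomogeneousIdeal 𝒜) {i : ℕ} {M X : GradedModuleCat 𝒜} {k l : ℕ}
    (h : k ≤ l) : restrict b h (0 : Ext (quotPow b M k) X i) = 0 :=
  Ext.comp_zero _ _ _ _ _

/-- The vanishing of `colim_k Ext^i(M / bᵏ M, X)`: every class dies in some `Ext^i(M / bˡ M, X)`. -/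
def ColimExtVanishes (b : HomogeneousIdeal 𝒜) (i : ℕ) (M X : GradedModuleCat 𝒜) : Prop :=
  ∀ (k : ℕ) (ξ : Ext (quotPow b M k) X i), ∃ (l : ℕ) (h : k ≤ l), restrict b h ξ = 0

/-! ### Enlarging the ideal by an element that kills the second argument -/

open Pointwise in
theorem mem_span_singleton_smul_top {x : R} {P : GradedModuleCat 𝒜} {z : P} :
    z ∈ Ideal.span {x} • (⊤ : Submodule R P) ↔ ∃ p : P, x • p = z := by
  rw [Submodule.ideal_span_singleton_smul, Submodule.mem_smul_pointwise_iff_exists]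
  simp

theorem mem_pow_smul_top {I : Ideal R} {x : R} (hI : I = Ideal.span {x}) (P : GradedModuleCat 𝒜)
    (j : ℕ) {z : P} : z ∈ I ^ j • (⊤ : Submodule R P) ↔ ∃ p : P, x ^ j • p = z := by
  rw [hI, Ideal.span_singleton_pow, mem_span_singleton_smul_top]

/-- The submodule `cʲ P`. -/
noncomputable abbrev powSub (c : HomogeneousIdeal 𝒜) (P : GradedModuleCat 𝒜) (j : ℕ) :
    GradedModuleCat 𝒜 :=
  P.sub _ (smul_top_isHomogeneous _ (pow_isHomogeneous c j) P)

/-- The inclusion `cʲ⁺¹ P ⟶ cʲ P`. -/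
noncomputable def powSubSucc (c : HomogeneousIdeal 𝒜) (P : GradedModuleCat 𝒜) (j : ℕ) :
    powSub c P (j + 1) ⟶ powSub c P j :=
  ofLin (X := powSub c P (j + 1)) (Y := powSub c P j)
    (Submodule.inclusion (Submodule.smul_mono_left (Ideal.pow_le_pow_right j.le_succ)))
    fun _ _ hx => hx

/-- Multiplication by the generator `x` of `c`, as a morphism `cʲ P ⟶ cʲ⁺¹ P (e)`. -/
noncomputable def powSubSmul {e : ℕ} {x : R} (hx : x ∈ 𝒜 e) (c : HomogeneousIdeal 𝒜)
    (hc : c.toIdeal = Ideal.span {x}) (P : GradedModuleCat 𝒜) (j : ℕ) :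
    powSub c P j ⟶ (powSub c P (j + 1)).shift e :=
  ofLin (X := powSub c P j) (Y := (powSub c P (j + 1)).shift e)
    ((LinearMap.lsmul R P x).restrict (p := c.toIdeal ^ j • (⊤ : Submodule R P))
      (q := c.toIdeal ^ (j + 1) • (⊤ : Submodule R P)) fun z hz => by
        rw [mem_pow_smul_top hc] at hz ⊢
        obtain ⟨p, rfl⟩ := hz
        exact ⟨p, by rw [pow_succ', mul_smul]; rfl⟩) fun n z hz => by
    have h := P.smul_mem (j := n) hx hz
    rw [add_comm] at h
    exact h

/-- For large `j`, the inclusion `cʲ⁺¹ P ⟶ cʲ P` factors through multiplication by the generator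
of `c`, since this generator acts injectively on `cʲ P`; hence it induces zero on `Ext(-, X)` if
the generator kills `X`. -/
theorem exists_powSubSucc_comp_eq_zero [IsNoetherianRing R] {e : ℕ} {x : R} (hx : x ∈ 𝒜 e)
    (c : HomogeneousIdeal 𝒜) (hc : c.toIdeal = Ideal.span {x}) (P : GradedModuleCat 𝒜)
    [Module.Finite R P] {X : GradedModuleCat 𝒜} (hX : ∀ z : X, x • z = 0) :
    ∃ j₀ : ℕ, ∀ j ≥ j₀, ∀ (i : ℕ) (η : Ext (powSub c P j) X i),
      (Ext.mk₀ (powSubSucc c P j)).comp η (zero_add i) = 0 := by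
  obtain ⟨j₀, h₀⟩ := Filter.eventually_atTop.1
    (Module.End.eventually_disjoint_ker_pow_range_pow (LinearMap.lsmul R P x))
  refine ⟨j₀ + 1, fun j hj i η => ?_⟩
  have hpow : ∀ (n : ℕ) (p : P), (LinearMap.lsmul R P x ^ n) p = x ^ n • p := fun n p => by
    induction n with
    | zero => simp
    | succ n ih => rw [pow_succ', Module.End.mul_apply, ih, pow_succ', mul_smul]; rfl
  have hbij : Function.Bijective (Hom.lin (powSubSmul hx c hc P j)) := by
    constructor
    · refine (injective_iff_map_eq_zero _).2 fun z hz => Subtype.ext ?_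
      have hz' : x • (z.1 : P) = 0 := congrArg Subtype.val hz
      refine Submodule.disjoint_def.1 (h₀ j (by lia)) z.1 ?_ ?_
      · obtain ⟨m, rfl⟩ : ∃ m, j = m + 1 := ⟨j - 1, by lia⟩
        rw [LinearMap.mem_ker, hpow, pow_succ, mul_smul, hz', smul_zero]
      · obtain ⟨p, hp⟩ := (mem_pow_smul_top hc P j).1 z.2
        exact ⟨p, by rw [hpow, hp]⟩
    · intro z
      obtain ⟨p, hp⟩ := (mem_pow_smul_top hc P (j + 1)).1 z.2
      refine ⟨⟨x ^ j • p, (mem_pow_smul_top hc P j).2 ⟨p, rfl⟩⟩, Subtype.ext ?_⟩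
      rw [pow_succ', mul_smul] at hp
      exact hp
  have := isIso_of_bijective _ hbij
  have hfac : powSubSucc c P j = smulHom hx _ ≫ inv (powSubSmul hx c hc P j) := by
    rw [IsIso.eq_comp_inv]
    rfl
  rw [hfac, ← Ext.mk₀_comp_mk₀_assoc]
  exact smulHom_comp_eq_zero hx hX i _ _

/-- If `x` kills `X`, then enlarging `b` by `x` does not change `colim_k Ext^i(M / bᵏ M, X)`; here
only the preservation of vanishing is recorded. A class over `M / (b + xR)ᵏ M` that dies on
`P = M / bˡ M` is compared with the tower `P / xʲ P`, where it comes from the connecting maps of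
`0 → xʲ P → P → P / xʲ P → 0`; the inclusions `xʲ⁺¹ P → xʲ P` kill it for large `j`. -/
theorem ColimExtVanishes.sup_of_smul_eq_zero [IsNoetherianRing R] {b : HomogeneousIdeal 𝒜}
    {i : ℕ} {M X : GradedModuleCat 𝒜} [Module.Finite R M] (hv : ColimExtVanishes b i M X)
    {e : ℕ} {x : R} (hx : x ∈ 𝒜 e) (c : HomogeneousIdeal 𝒜) (hc : c.toIdeal = Ideal.span {x})
    (hX : ∀ z : X, x • z = 0) : ColimExtVanishes (b ⊔ c) i M X := by
  intro k ξ
  have hb : ∀ n, b.toIdeal ^ n ≤ (b ⊔ c).toIdeal ^ n := fun n =>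
    Ideal.pow_right_mono (by rw [HomogeneousIdeal.toIdeal_sup]; exact le_sup_left) n
  have hc' : ∀ n, c.toIdeal ^ n ≤ (b ⊔ c).toIdeal ^ n := fun n =>
    Ideal.pow_right_mono (by rw [HomogeneousIdeal.toIdeal_sup]; exact le_sup_right) n
  let α : quotPow b M k ⟶ quotPow (b ⊔ c) M k := quotPowDesc b k (quotPowπ _ M k)
    ((hb k).trans (pow_le_annihilator_quotPow _ M k))
  obtain ⟨l, hkl, hl⟩ := hv k ((Ext.mk₀ α).comp ξ (zero_add i))
  let P := quotPow b M l
  let f : P ⟶ quotPow (b ⊔ c) M k := quotPowMap b M hkl ≫ α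
  have hf : (Ext.mk₀ f).comp ξ (zero_add i) = 0 := by
    rw [restrict, Ext.mk₀_comp_mk₀_assoc] at hl
    exact hl
  let β : ∀ j, k ≤ j → (quotPow c P j ⟶ quotPow (b ⊔ c) M k) := fun j hj =>
    quotPowDesc c j f ((Ideal.pow_le_pow_right hj).trans
      ((hc' k).trans (pow_le_annihilator_quotPow _ M k)))
  let γ : ∀ j, quotPow (b ⊔ c) M (l + j) ⟶ quotPow c P j := fun j =>
    quotPowDesc (b ⊔ c) (l + j) (quotPowπ b M l ≫ quotPowπ c P j) (by
      rw [HomogeneousIdeal.toIdeal_sup]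
      refine Ideal.sup_pow_add_le_pow_sup_pow.trans (sup_le ?_ (pow_le_annihilator_quotPow c P j))
      exact (pow_le_annihilator_quotPow b M l).trans
        (annihilator_le_of_surjective _ (quotPowπ_surjective c P j)))
  have hβ : ∀ j (hj : k ≤ j), quotPowπ c P j ≫ β j hj = f := fun j hj =>
    quotPowπ_comp_quotPowDesc _ _ _ _
  suffices h : ∃ j, ∃ hj : k ≤ j, (Ext.mk₀ (β j hj)).comp ξ (zero_add i) = 0 by
    obtain ⟨j, hj, h⟩ := h
    refine ⟨l + j, by lia, ?_⟩
    have hγ : quotPowMap (b ⊔ c) M (by lia : k ≤ l + j) = γ j ≫ β j hj := by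
      rw [← cancel_epi (quotPowπ (b ⊔ c) M (l + j)), ← Category.assoc,
        quotPowπ_comp_quotPowMap, quotPowπ_comp_quotPowDesc, Category.assoc, hβ j hj, ← Category.assoc,
        quotPowπ_comp_quotPowMap, quotPowπ_comp_quotPowDesc]
    rw [restrict, hγ, ← Ext.mk₀_comp_mk₀_assoc, h, Ext.comp_zero]
  cases i with
  | zero =>
    have h : (Ext.mk₀ (quotPowπ c P k)).comp
        ((Ext.mk₀ (β k le_rfl)).comp ξ (zero_add 0)) (zero_add 0) = 0 := by
      rw [Ext.mk₀_comp_mk₀_assoc, hβ k le_rfl, hf]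
    exact ⟨k, le_rfl, (injective_iff_map_eq_zero _).1
      (Ext.precomp_mk₀_injective_of_epi X (quotPowπ c P k)) _ h⟩
  | succ i =>
    obtain ⟨j₀, h₀⟩ := exists_powSubSucc_comp_eq_zero hx c hc P hX
    let j := max k j₀
    have hj : k ≤ j := le_max_left _ _
    have hS : ∀ j, (ShortComplex.mk _ _ (P.subι_quotπ _
        (smul_top_isHomogeneous _ (pow_isHomogeneous c j) P))).ShortExact := fun j =>
      shortExact_sub_quot _ _ _
    obtain ⟨η, hη⟩ := Ext.contravariant_sequence_exact₃ (hS j) X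
      ((Ext.mk₀ (β j hj)).comp ξ (zero_add _)) (by
        change (Ext.mk₀ (quotPowπ c P j)).comp _ _ = 0
        rw [Ext.mk₀_comp_mk₀_assoc, hβ j hj, hf]) (add_comm 1 i)
    let φ : ShortComplex.mk _ _ (P.subι_quotπ _
          (smul_top_isHomogeneous _ (pow_isHomogeneous c (j + 1)) P)) ⟶
        ShortComplex.mk _ _ (P.subι_quotπ _
          (smul_top_isHomogeneous _ (pow_isHomogeneous c j) P)) :=
      { τ₁ := powSubSucc c P j
        τ₂ := 𝟙 P
        τ₃ := quotPowMap c P j.le_succ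
        comm₁₂ := rfl
        comm₂₃ := rfl }
    have hj' : k ≤ j + 1 := hj.trans j.le_succ
    refine ⟨j + 1, hj', ?_⟩
    have hβ' : β (j + 1) hj' = quotPowMap c P j.le_succ ≫ β j hj := by
      rw [← cancel_epi (quotPowπ c P (j + 1)), hβ _ hj', ← Category.assoc,
        quotPowπ_comp_quotPowMap, hβ j hj]
    rw [hβ', ← Ext.mk₀_comp_mk₀_assoc, ← hη]
    refine (mk₀_comp_extClass_comp (hS (j + 1)) (hS j) φ η).trans ?_
    change (hS (j + 1)).extClass.comp ((Ext.mk₀ (powSubSucc c P j)).comp η _) _ = 0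
    rw [h₀ j (le_max_right _ _), Ext.comp_zero]
    rfl

/-! ### Exactness of `colim_k Ext^i(M / bᵏ M, -)` -/

section ShortExact

variable {b : HomogeneousIdeal 𝒜} {i : ℕ} {M : GradedModuleCat 𝒜}
  {S : ShortComplex (GradedModuleCat 𝒜)}

theorem ColimExtVanishes.exists_restrict_eq_zero_of_comp_g (hv : ColimExtVanishes b i M S.X₁)
    (hS : S.ShortExact) {k : ℕ} (ξ : Ext (quotPow b M k) S.X₂ i)
    (hξ : ξ.comp (Ext.mk₀ S.g) (add_zero i) = 0) : ∃ (l : ℕ) (h : k ≤ l), restrict b h ξ = 0 := by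
  obtain ⟨η, rfl⟩ := Ext.covariant_sequence_exact₂ _ hS ξ hξ
  obtain ⟨l, h, hl⟩ := hv k η
  exact ⟨l, h, by rw [restrict_comp, hl, Ext.zero_comp]⟩

theorem exists_restrict_eq_zero_of_comp_f
    (hv : ∀ j, j + 1 = i → ColimExtVanishes b j M S.X₃)
    (hS : S.ShortExact) {k : ℕ} (ξ : Ext (quotPow b M k) S.X₁ i)
    (hξ : ξ.comp (Ext.mk₀ S.f) (add_zero i) = 0) : ∃ (l : ℕ) (h : k ≤ l), restrict b h ξ = 0 := by
  cases i with
  | zero =>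
    have := hS.mono_f
    refine ⟨k, le_rfl, ?_⟩
    rw [(injective_iff_map_eq_zero _).1 (Ext.postcomp_mk₀_injective_of_mono _ S.f) ξ hξ,
      restrict_zero]
  | succ i =>
    obtain ⟨η, rfl⟩ := Ext.covariant_sequence_exact₁ _ hS ξ hξ rfl
    obtain ⟨l, h, hl⟩ := hv i rfl k η
    exact ⟨l, h, by rw [restrict_comp, hl, Ext.zero_comp]⟩

theorem ColimExtVanishes.exists_comp_g_eq_restrict (hv : ColimExtVanishes b (i + 1) M S.X₁)
    (hS : S.ShortExact) {k : ℕ} (ξ : Ext (quotPow b M k) S.X₃ i) :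
    ∃ (l : ℕ) (h : k ≤ l) (κ : Ext (quotPow b M l) S.X₂ i),
      κ.comp (Ext.mk₀ S.g) (add_zero i) = restrict b h ξ := by
  obtain ⟨l, h, hl⟩ := hv k (ξ.comp hS.extClass rfl)
  rw [restrict_comp] at hl
  exact ⟨l, h, Ext.covariant_sequence_exact₃ _ hS _ rfl hl⟩

theorem ColimExtVanishes.exists_comp_f_eq_restrict (hv : ColimExtVanishes b i M S.X₃)
    (hS : S.ShortExact) {k : ℕ} (ξ : Ext (quotPow b M k) S.X₂ i) :
    ∃ (l : ℕ) (h : k ≤ l) (κ : Ext (quotPow b M l) S.X₁ i),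
      κ.comp (Ext.mk₀ S.f) (add_zero i) = restrict b h ξ := by
  obtain ⟨l, h, hl⟩ := hv k (ξ.comp (Ext.mk₀ S.g) (add_zero i))
  rw [restrict_comp] at hl
  exact ⟨l, h, Ext.covariant_sequence_exact₂ _ hS _ hl⟩

end ShortExact

/-! ### Multiplication on the second argument -/

section Multiplication

variable {e : ℕ} {x : R}

theorem isHomogeneous_span_singleton (hx : x ∈ 𝒜 e) : (Ideal.span {x}).IsHomogeneous 𝒜 :=
  Ideal.homogeneous_span 𝒜 {x} (by
    rintro _ rfl
    exact ⟨e, hx⟩)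

/-- The submodule `0 :_N x`. -/
noncomputable abbrev smulKer (hx : x ∈ 𝒜 e) (N : GradedModuleCat 𝒜) : GradedModuleCat 𝒜 :=
  ker (smulHom hx N)

/-- The submodule `xN`. -/
noncomputable abbrev smulRange (hx : x ∈ 𝒜 e) (N : GradedModuleCat 𝒜) : GradedModuleCat 𝒜 :=
  N.sub _ (smul_top_isHomogeneous _ (isHomogeneous_span_singleton hx) N)

/-- The quotient `N / xN`. -/
noncomputable abbrev smulCoker (hx : x ∈ 𝒜 e) (N : GradedModuleCat 𝒜) : GradedModuleCat 𝒜 :=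
  N.quot _ (smul_top_isHomogeneous _ (isHomogeneous_span_singleton hx) N)

theorem smul_smulKer (hx : x ∈ 𝒜 e) (N : GradedModuleCat 𝒜) (z : smulKer hx N) : x • z = 0 :=
  Subtype.ext z.2

theorem smul_smulCoker (hx : x ∈ 𝒜 e) (N : GradedModuleCat 𝒜) (z : smulCoker hx N) :
    x • z = 0 := by
  obtain ⟨z, rfl⟩ := quotπ_surjective _ _ _ z
  rw [← map_smul]
  exact (Submodule.Quotient.mk_eq_zero _).2 (mem_span_singleton_smul_top.2 ⟨z, rfl⟩)

/-- Multiplication by a homogeneous element `x` of degree `e`, as a morphism `N(n) ⟶ N(n + e)`. -/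
noncomputable def smulShift (hx : x ∈ 𝒜 e) (N : GradedModuleCat 𝒜) {n m : ℤ} (h : n + e = m) :
    N.shift n ⟶ N.shift m :=
  ofLin (X := N.shift n) (Y := N.shift m) (LinearMap.lsmul R N x) fun a z hz => by
    have h' := N.smul_mem (j := a + n) hx hz
    rwa [show (e : ℤ) + (a + n) = a + m by rw [← h]; ring] at h'

/-- Multiplication by `x`, as a morphism `N(n) ⟶ (xN)(n + e)`. -/
noncomputable def smulShiftRange (hx : x ∈ 𝒜 e) (N : GradedModuleCat 𝒜) {n m : ℤ}
    (h : n + e = m) : N.shift n ⟶ (smulRange hx N).shift m :=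
  ofLin (X := N.shift n) (Y := (smulRange hx N).shift m)
    ((LinearMap.lsmul R N x).codRestrict (Ideal.span {x} • (⊤ : Submodule R N)) fun z =>
      mem_span_singleton_smul_top.2 ⟨z, rfl⟩) fun _ _ hz => lin_mem (smulShift hx N h) hz

/-- The inclusion `(xN)(m) ⟶ N(m)`. -/
noncomputable abbrev smulRangeι (hx : x ∈ 𝒜 e) (N : GradedModuleCat 𝒜) (m : ℤ) :
    (smulRange hx N).shift m ⟶ N.shift m :=
  shiftMap (N.subι _ (smul_top_isHomogeneous _ (isHomogeneous_span_singleton hx) N)) m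

theorem smulShiftRange_comp (hx : x ∈ 𝒜 e) (N : GradedModuleCat 𝒜) {n m : ℤ} (h : n + e = m) :
    smulShiftRange hx N h ≫ smulRangeι hx N m = smulShift hx N h := rfl

theorem kerι_comp_smulShiftRange (hx : x ∈ 𝒜 e) (N : GradedModuleCat 𝒜) {n m : ℤ}
    (h : n + e = m) : shiftMap (kerι (smulHom hx N)) n ≫ smulShiftRange hx N h = 0 :=
  hom_ext fun z => Subtype.ext z.2

theorem shortExact_smulShiftRange (hx : x ∈ 𝒜 e) (N : GradedModuleCat 𝒜) {n m : ℤ}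
    (h : n + e = m) :
    (ShortComplex.mk _ _ (kerι_comp_smulShiftRange hx N h)).ShortExact := by
  refine shortExact_of_lin _ _ _ (N.subι_injective _ (ker_isHomogeneous (smulHom hx N)))
    (fun z => ?_) fun z hz => ?_
  · obtain ⟨p, hp⟩ := mem_span_singleton_smul_top.1 z.2
    exact ⟨p, Subtype.ext hp⟩
  · exact ⟨(⟨z, congrArg Subtype.val hz⟩ : LinearMap.ker (Hom.lin (smulHom hx N))), rfl⟩

variable {c : HomogeneousIdeal 𝒜} {i : ℕ} {M N : GradedModuleCat 𝒜} {n m : ℤ}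

/-- Multiplication by `x` is injective on `colim_k Ext^i(M / cᵏ M, N(n))` if the colimits for
`0 :_N x` and `N / xN` vanish in the relevant degrees. -/
theorem exists_restrict_eq_zero_of_comp_smulShift (hx : x ∈ 𝒜 e) (h : n + e = m)
    (hK : ColimExtVanishes c i M ((smulKer hx N).shift n))
    (hQ : ∀ j, j + 1 = i → ColimExtVanishes c j M ((smulCoker hx N).shift m)) {k : ℕ}
    (ξ : Ext (quotPow c M k) (N.shift n) i)
    (hξ : ξ.comp (Ext.mk₀ (smulShift hx N h)) (add_zero i) = 0) :
    ∃ (l : ℕ) (h : k ≤ l), restrict c h ξ = 0 := by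
  rw [← smulShiftRange_comp, ← Ext.mk₀_comp_mk₀, ← Ext.comp_assoc_of_third_deg_zero] at hξ
  obtain ⟨l, hl, h₁⟩ := exists_restrict_eq_zero_of_comp_f hQ
    (shortExact_sub_quot_shift N _
      (smul_top_isHomogeneous _ (isHomogeneous_span_singleton hx) N) m) _ hξ
  rw [restrict_comp] at h₁
  obtain ⟨l', hl', h₂⟩ :=
    hK.exists_restrict_eq_zero_of_comp_g (shortExact_smulShiftRange hx N h) _ h₁
  rw [restrict_restrict] at h₂
  exact ⟨l', hl.trans hl', h₂⟩

/-- Multiplication by `x` from `colim_k Ext^i(M / cᵏ M, N(n))` to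
`colim_k Ext^i(M / cᵏ M, N(n + e))` is surjective if the colimits for `0 :_N x` and `N / xN`
vanish in the relevant degrees. -/
theorem exists_comp_smulShift_eq_restrict (hx : x ∈ 𝒜 e) (h : n + e = m)
    (hK : ColimExtVanishes c (i + 1) M ((smulKer hx N).shift n))
    (hQ : ColimExtVanishes c i M ((smulCoker hx N).shift m)) {k : ℕ}
    (ξ : Ext (quotPow c M k) (N.shift m) i) :
    ∃ (l : ℕ) (hl : k ≤ l) (κ : Ext (quotPow c M l) (N.shift n) i),
      κ.comp (Ext.mk₀ (smulShift hx N h)) (add_zero i) = restrict c hl ξ := by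
  obtain ⟨l, hl, θ, hθ⟩ := hQ.exists_comp_f_eq_restrict
    (shortExact_sub_quot_shift N _
      (smul_top_isHomogeneous _ (isHomogeneous_span_singleton hx) N) m) ξ
  obtain ⟨l', hl', κ, hκ⟩ :=
    hK.exists_comp_g_eq_restrict (shortExact_smulShiftRange hx N h) θ
  refine ⟨l', hl.trans hl', κ, ?_⟩
  rw [← restrict_restrict c hl hl', ← hθ, restrict_comp, ← hκ, ← smulShiftRange_comp, ← Ext.mk₀_comp_mk₀,
    ← Ext.comp_assoc_of_third_deg_zero]

end Multiplication

/-! ### Vanishing in small degrees for ideals extended from degree zero -/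

theorem ColimExtVanishes.of_ext_eq_zero {b : HomogeneousIdeal 𝒜} {i : ℕ}
    {M X : GradedModuleCat 𝒜} (h : ∀ k (ξ : Ext (quotPow b M k) X i), ξ = 0) :
    ColimExtVanishes b i M X := fun k ξ => ⟨k, le_rfl, by rw [h k ξ, restrict_zero]⟩

/-- The vanishing, for all finitely generated `M` and `N` and all `i`, of `H^i_b(M, N)ₙ` for
`n ≪ 0`. -/
def VanishesAtBot (b : HomogeneousIdeal 𝒜) : Prop :=
  ∀ (M N : GradedModuleCat 𝒜) [Module.Finite R M] [Module.Finite R N] (i : ℕ),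
    ∃ n₀ : ℤ, ∀ n ≤ n₀, ColimExtVanishes b i M (N.shift n)

/-- For `b = 0` the modules `H^i_b(M, N)ₙ` are `Ext^i(M, N)ₙ`. -/
theorem VanishesAtBot.of_toIdeal_eq_bot [IsNoetherianRing R] {b : HomogeneousIdeal 𝒜}
    (hb : b.toIdeal = ⊥) : VanishesAtBot b := by
  intro M N _ _ i
  obtain ⟨n₀, h₀⟩ := ext_eq_zero_of_le N i M
  refine ⟨n₀, fun n hn k ξ => ⟨k + 1, k.le_succ, ?_⟩⟩
  -- `M / bᵏ⁺¹ M` is isomorphic to `M`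
  have hbij : Function.Bijective (Hom.lin (quotPowπ b M (k + 1))) := by
    refine ⟨(injective_iff_map_eq_zero _).2 fun z hz => ?_, quotPowπ_surjective b M (k + 1)⟩
    have hz' := (Submodule.Quotient.mk_eq_zero _).1 hz
    rwa [hb, pow_succ, Ideal.mul_bot, Submodule.bot_smul, Submodule.mem_bot] at hz'
  have := isIso_of_bijective _ hbij
  have h := h₀ n hn ((Ext.mk₀ (quotPowπ b M (k + 1))).comp (restrict b k.le_succ ξ) (zero_add i))
  have h' := congrArg (fun ζ => (Ext.mk₀ (inv (quotPowπ b M (k + 1)))).comp ζ (zero_add i)) h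
  simpa using h'

/-- For modules `N` killed by `x`, vanishing in small degrees passes from `b` to `b + xR`; the bound
is uniform in the finitely many cohomological degrees `j ≤ i`. -/
theorem VanishesAtBot.exists_of_smul_eq_zero [IsNoetherianRing R] {b : HomogeneousIdeal 𝒜}
    (hb : VanishesAtBot b) {e : ℕ} {x : R} (hx : x ∈ 𝒜 e) (c : HomogeneousIdeal 𝒜)
    (hc : c.toIdeal = Ideal.span {x}) (M N : GradedModuleCat 𝒜) [Module.Finite R M]
    [Module.Finite R N] (hN : ∀ z : N, x • z = 0) (i : ℕ) :
    ∃ n₀ : ℤ, ∀ n ≤ n₀, ∀ j ≤ i, ColimExtVanishes (b ⊔ c) j M (N.shift n) := by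
  choose n₀ h₀ using hb M N
  obtain ⟨l, hl⟩ := ((Finset.range (i + 1)).image n₀).bddBelow
  refine ⟨l, fun n hn j hj => (h₀ j n (hn.trans (hl ?_))).sup_of_smul_eq_zero hx c hc hN⟩
  exact Finset.mem_coe.2 (Finset.mem_image_of_mem n₀ (Finset.mem_range.2 (by lia)))

/-- Vanishing in small degrees passes from `b` to `b + xR` for `x ∈ R₀`: in small degrees
multiplication by `x` is injective on `H^i_{b+xR}(M, N)ₙ`, and this module is `x`-torsion. -/
theorem VanishesAtBot.sup [IsNoetherianRing R] {b : HomogeneousIdeal 𝒜} (hb : VanishesAtBot b)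
    {x : R} (hx : x ∈ 𝒜 0) (c : HomogeneousIdeal 𝒜) (hc : c.toIdeal = Ideal.span {x}) :
    VanishesAtBot (b ⊔ c) := by
  intro M N _ _ i
  obtain ⟨n₁, h₁⟩ := hb.exists_of_smul_eq_zero hx c hc M (smulKer hx N) (smul_smulKer hx N) i
  obtain ⟨n₂, h₂⟩ := hb.exists_of_smul_eq_zero hx c hc M (smulCoker hx N) (smul_smulCoker hx N) i
  refine ⟨min n₁ n₂, fun n hn k ξ => ?_⟩
  let r : 𝒜 0 := ⟨x, hx⟩
  have hsmul : ∀ k (ζ : Ext (quotPow (b ⊔ c) M k) (N.shift n) i),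
      ζ.comp (Ext.mk₀ (smulShift hx N (by simp : n + (0 : ℕ) = n))) (add_zero i) = r • ζ :=
    fun k ζ => by
      rw [Ext.smul_eq_comp_mk₀]
      rfl
  -- multiplication by `x` is injective on the colimit, so a class killed by a power of `x` dies
  have key : ∀ (j k : ℕ) (ξ : Ext (quotPow (b ⊔ c) M k) (N.shift n) i), r ^ j • ξ = 0 →
      ∃ (l : ℕ) (h : k ≤ l), restrict (b ⊔ c) h ξ = 0 := by
    intro j
    induction j with
    | zero =>
      intro k ξ hξ
      rw [pow_zero, one_smul] at hξ
      exact ⟨k, le_rfl, by rw [hξ, restrict_zero]⟩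
    | succ j ih =>
      intro k ξ hξ
      rw [pow_succ, mul_smul] at hξ
      obtain ⟨l, hl, h⟩ := ih k _ hξ
      rw [← hsmul, restrict_comp] at h
      obtain ⟨l', hl', h'⟩ := exists_restrict_eq_zero_of_comp_smulShift hx _
        (h₁ n (hn.trans (min_le_left _ _)) i le_rfl)
        (fun j hj => h₂ n (hn.trans (min_le_right _ _)) j (by lia)) _ h
      rw [restrict_restrict] at h'
      exact ⟨l', hl.trans hl', h'⟩
  refine key k k ξ ?_
  have hzero : r ^ k • 𝟙 (quotPow (b ⊔ c) M k) = 0 := hom_ext fun z => by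
    refine Module.mem_annihilator.1 (pow_le_annihilator_quotPow (b ⊔ c) M k ?_) z
    refine Ideal.pow_mem_pow ?_ k
    rw [HomogeneousIdeal.toIdeal_sup, hc]
    exact Ideal.mem_sup_right (Ideal.mem_span_singleton_self x)
  rw [← Ext.mk₀_id_comp (r ^ k • ξ), Ext.comp_smul, ← Ext.smul_comp, ← Ext.mk₀_smul, hzero,
    Ext.mk₀_zero, Ext.zero_comp]

theorem toIdeal_extendGradeZero (a : Ideal (𝒜 0)) :
    (HomogeneousIdeal.extendGradeZero 𝒜 a).toIdeal = a.map (algebraMap (𝒜 0) R) := rfl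

/-- `H^i_{a₀R}(M, N)ₙ` vanishes for `n ≪ 0`. -/
theorem vanishesAtBot_extendGradeZero [IsNoetherianRing R] (a₀ : Ideal (𝒜 0)) :
    VanishesAtBot (HomogeneousIdeal.extendGradeZero 𝒜 a₀) := by
  classical
  have : IsNoetherianRing (𝒜 0) := isNoetherianRing_of_surjective R (𝒜 0)
    (GradedRing.projZeroRingHom' 𝒜) (GradedRing.projZeroRingHom'_surjective 𝒜)
  obtain ⟨s, rfl⟩ := (isNoetherianRing_iff_ideal_fg (𝒜 0)).1 this a₀
  induction s using Finset.induction_on with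
  | empty =>
    refine VanishesAtBot.of_toIdeal_eq_bot ?_
    rw [toIdeal_extendGradeZero, Finset.coe_empty, Ideal.span_empty, Ideal.map_bot]
  | insert x s _ ih =>
    have h : HomogeneousIdeal.extendGradeZero 𝒜 (Submodule.span _ ((insert x s : Finset _) : Set _))
        = HomogeneousIdeal.extendGradeZero 𝒜 (Submodule.span _ (s : Set _)) ⊔
          HomogeneousIdeal.extendGradeZero 𝒜 (Ideal.span {x}) := by
      refine HomogeneousIdeal.toIdeal_injective ?_
      rw [HomogeneousIdeal.toIdeal_sup]
      simp only [toIdeal_extendGradeZero]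
      rw [← Ideal.map_sup, Finset.coe_insert, Submodule.span_insert, sup_comm]
    rw [h]
    refine ih.sup x.2 _ ?_
    rw [toIdeal_extendGradeZero, Ideal.map_span, Set.image_singleton]
    rfl

/-! ### Multiplication isomorphisms between components of local cohomology -/

theorem extTransition_apply (c : HomogeneousIdeal 𝒜) (i : ℕ) (M N : GradedModuleCat 𝒜) (n : ℤ)
    {k l : ℕ} (h : k ≤ l) (ξ : ExtDeg i (quotPow c M k) N n) :
    extTransition c i M N n k l h ξ = restrict c h ξ := rfl

instance (c : HomogeneousIdeal 𝒜) (i : ℕ) (M N : GradedModuleCat 𝒜) (n : ℤ) :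
    DirectedSystem (fun k => ExtDeg i (quotPow c M k) N n)
      fun k l h => extTransition c i M N n k l h where
  map_self k ξ := by
    have h : quotPowMap c M (le_refl k) = 𝟙 _ := by
      rw [← cancel_epi (quotPowπ c M k), quotPowπ_comp_quotPowMap, Category.comp_id]
    rw [extTransition_apply, restrict, h, Ext.mk₀_id_comp]
  map_map k j l hij hjk ξ := restrict_restrict c hij hjk ξ

/-- Multiplication by `x` is an isomorphism `H^i_c(M, N)ₙ ≅ H^i_c(M, N)ₙ₊ₑ` if the cohomology of
`0 :_N x` and of `N / xN` vanishes in the relevant degrees. -/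
theorem nonempty_localCohomologyDeg_equiv {e : ℕ} {x : R} (hx : x ∈ 𝒜 e)
    {c : HomogeneousIdeal 𝒜} {i : ℕ} {M N : GradedModuleCat 𝒜} {n m : ℤ} (h : n + e = m)
    (hK : ∀ j ≤ i + 1, ColimExtVanishes c j M ((smulKer hx N).shift n))
    (hQ : ∀ j ≤ i, ColimExtVanishes c j M ((smulCoker hx N).shift m)) :
    Nonempty (LocalCohomologyDeg c i M N n ≃ₗ[𝒜 0] LocalCohomologyDeg c i M N m) := by
  let μ : ∀ k, ExtDeg i (quotPow c M k) N n →ₗ[𝒜 0] ExtDeg i (quotPow c M k) N m := fun k =>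
    (Ext.mk₀ (smulShift hx N h)).postcompOfLinear (𝒜 0) _ (add_zero i)
  have hμ : ∀ k l hkl, μ l ∘ₗ extTransition c i M N n k l hkl =
      extTransition c i M N m k l hkl ∘ₗ μ k := fun k l hkl =>
    LinearMap.ext fun ξ => (restrict_comp c hkl ξ (Ext.mk₀ (smulShift hx N h)) (add_zero i)).symm
  refine ⟨LinearEquiv.ofBijective (Module.DirectLimit.map μ hμ) ⟨?_, fun z => ?_⟩⟩
  · refine (injective_iff_map_eq_zero _).2 fun z hz => ?_
    obtain ⟨k, ξ, rfl⟩ := Module.DirectLimit.exists_of z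
    rw [Module.DirectLimit.map_apply_of] at hz
    obtain ⟨l, hl, h₁⟩ := Module.DirectLimit.of.zero_exact hz
    rw [extTransition_apply] at h₁
    obtain ⟨l', hl', h₂⟩ := exists_restrict_eq_zero_of_comp_smulShift hx h (hK i i.le_succ)
      (fun j hj => hQ j (by lia)) (restrict c hl ξ) (by rw [← restrict_comp]; exact h₁)
    rw [← Module.DirectLimit.of_f (hij := hl), ← Module.DirectLimit.of_f (hij := hl'),
      extTransition_apply, extTransition_apply, h₂, map_zero]
  · obtain ⟨k, ξ, rfl⟩ := Module.DirectLimit.exists_of z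
    obtain ⟨l, hl, κ, hκ⟩ :=
      exists_comp_smulShift_eq_restrict hx h (hK (i + 1) le_rfl) (hQ i le_rfl) ξ
    refine ⟨Module.DirectLimit.of _ _ _ _ l κ, ?_⟩
    rw [Module.DirectLimit.map_apply_of, ← Module.DirectLimit.of_f (hij := hl)]
    exact congrArg _ hκ

/-- The cohomology of `0 :_N y` and `N / yN` with respect to `b + yR` vanishes in small degrees,
because `y` kills these modules and their cohomology with respect to `b` does. -/
theorem exists_nonempty_equiv_succ_of_le [IsNoetherianRing R] {b : HomogeneousIdeal 𝒜}
    (hb : VanishesAtBot b) {y : R} (hy : y ∈ 𝒜 1) (c : HomogeneousIdeal 𝒜)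
    (hc : c.toIdeal = Ideal.span {y}) (M N : GradedModuleCat 𝒜) [Module.Finite R M]
    [Module.Finite R N] (i : ℕ) :
    ∃ n₀ : ℤ, ∀ n < n₀, Nonempty (LocalCohomologyDeg (b ⊔ c) i M N n ≃ₗ[𝒜 0]
      LocalCohomologyDeg (b ⊔ c) i M N (n + 1)) := by
  obtain ⟨n₁, h₁⟩ :=
    hb.exists_of_smul_eq_zero hy c hc M (smulKer hy N) (smul_smulKer hy N) (i + 1)
  obtain ⟨n₂, h₂⟩ := hb.exists_of_smul_eq_zero hy c hc M (smulCoker hy N) (smul_smulCoker hy N) i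
  refine ⟨min n₁ n₂, fun n hn => nonempty_localCohomologyDeg_equiv hy (by simp)
    (h₁ n ?_) (h₂ (n + 1) ?_)⟩
  · exact hn.le.trans (min_le_left _ _)
  · exact (Int.add_one_le_of_lt hn).trans (min_le_right _ _)

/-- If the irrelevant ideal is generated by `y`, then a finitely generated graded module killed by
`y` is concentrated in finitely many degrees, so its cohomology vanishes in large degrees. -/
theorem exists_colimExtVanishes_of_ge [IsNoetherianRing R] (c : HomogeneousIdeal 𝒜) {y : R}
    (hirr : (HomogeneousIdeal.irrelevant 𝒜).toIdeal = Ideal.span {y})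
    (M N : GradedModuleCat 𝒜) [Module.Finite R M] [Module.Finite R N] (hN : ∀ z : N, y • z = 0) :
    ∃ n₀ : ℤ, ∀ n ≥ n₀, ∀ i, ColimExtVanishes c i M (N.shift n) := by
  obtain ⟨d, hd⟩ := M.exists_forall_deg_eq_bot_of_lt
  obtain ⟨a, ha⟩ := N.exists_forall_deg_eq_bot_of_gt hirr hN
  refine ⟨a + 1 - d, fun n hn i => .of_ext_eq_zero fun k ξ => ?_⟩
  refine ext_eq_zero_of_ge N (c := d) (fun m hm => ha m (by linarith)) i _ (fun m hm => ?_) ξ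
  exact deg_eq_bot_of_surjective _ (quotPowπ_surjective c M k) (hd m hm)

theorem exists_nonempty_equiv_succ_of_ge [IsNoetherianRing R] (c : HomogeneousIdeal 𝒜) {y : R}
    (hy : y ∈ 𝒜 1) (hirr : (HomogeneousIdeal.irrelevant 𝒜).toIdeal = Ideal.span {y})
    (M N : GradedModuleCat 𝒜) [Module.Finite R M] [Module.Finite R N] (i : ℕ) :
    ∃ n₀ : ℤ, ∀ n ≥ n₀, Nonempty (LocalCohomologyDeg c i M N n ≃ₗ[𝒜 0]
      LocalCohomologyDeg c i M N (n + 1)) := by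
  obtain ⟨n₁, h₁⟩ :=
    exists_colimExtVanishes_of_ge c hirr M (smulKer hy N) (smul_smulKer hy N)
  obtain ⟨n₂, h₂⟩ := exists_colimExtVanishes_of_ge c hirr M (smulCoker hy N) (smul_smulCoker hy N)
  refine ⟨max n₁ n₂, fun n hn => nonempty_localCohomologyDeg_equiv hy (by simp)
    (fun j _ => h₁ n ?_ j) (fun j _ => h₂ (n + 1) ?_ j)⟩
  · exact (le_max_left _ _).trans hn
  · exact (le_max_right _ _).trans (hn.trans (by simp))

/-- The components of `H^i_{b+yR}(M, N)` in small degrees are all isomorphic. -/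
theorem exists_nonempty_equiv_of_le [IsNoetherianRing R] {b : HomogeneousIdeal 𝒜}
    (hb : VanishesAtBot b) {y : R} (hy : y ∈ 𝒜 1) (c : HomogeneousIdeal 𝒜)
    (hc : c.toIdeal = Ideal.span {y}) (M N : GradedModuleCat 𝒜) [Module.Finite R M]
    [Module.Finite R N] (i : ℕ) :
    ∃ n₀ : ℤ, ∀ n ≤ n₀, Nonempty (LocalCohomologyDeg (b ⊔ c) i M N n ≃ₗ[𝒜 0]
      LocalCohomologyDeg (b ⊔ c) i M N n₀) := by
  obtain ⟨n₀, h₀⟩ := exists_nonempty_equiv_succ_of_le hb hy c hc M N i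
  refine ⟨n₀, fun n hn => ?_⟩
  induction n, hn using Int.leInductionDown with
  | base => exact ⟨LinearEquiv.refl _ _⟩
  | pred n hn ih =>
    obtain ⟨f⟩ := ih
    obtain ⟨g⟩ := h₀ (n - 1) (by lia)
    rw [sub_add_cancel] at g
    exact ⟨g.trans f⟩

/-- If the irrelevant ideal is generated by `y ∈ R₁`, then the components of `H^i_c(M, N)` in large
degrees are all isomorphic. -/
theorem exists_nonempty_equiv_of_ge [IsNoetherianRing R] (c : HomogeneousIdeal 𝒜) {y : R}
    (hy : y ∈ 𝒜 1) (hirr : (HomogeneousIdeal.irrelevant 𝒜).toIdeal = Ideal.span {y})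
    (M N : GradedModuleCat 𝒜) [Module.Finite R M] [Module.Finite R N] (i : ℕ) :
    ∃ n₀ : ℤ, ∀ n ≥ n₀, Nonempty (LocalCohomologyDeg c i M N n ≃ₗ[𝒜 0]
      LocalCohomologyDeg c i M N n₀) := by
  obtain ⟨n₀, h₀⟩ := exists_nonempty_equiv_succ_of_ge c hy hirr M N i
  refine ⟨n₀, fun n hn => ?_⟩
  induction n, hn using Int.leInduction with
  | base => exact ⟨LinearEquiv.refl _ _⟩
  | succ n hn ih =>
    obtain ⟨f⟩ := ih
    obtain ⟨g⟩ := h₀ n hn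
    exact ⟨g.symm.trans f⟩

/-! ### Principal irrelevant ideals -/

/-- In a standard graded ring, a principal irrelevant ideal is generated by an element of degree
one, namely the degree one component of any generator. -/
theorem exists_irrelevant_eq_span (hstd : Algebra.adjoin (𝒜 0) (𝒜 1 : Set R) = ⊤)
    (h : (HomogeneousIdeal.irrelevant 𝒜).toIdeal.IsPrincipal) :
    ∃ y ∈ 𝒜 1, (HomogeneousIdeal.irrelevant 𝒜).toIdeal = Ideal.span {y} := by
  obtain ⟨f, hf⟩ := h.principal
  have hf0 : (decompose 𝒜 f 0 : R) = 0 :=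
    hf.ge (Submodule.mem_span_singleton_self f)
  have hle : Ideal.span {(decompose 𝒜 f 1 : R)} ≤ (HomogeneousIdeal.irrelevant 𝒜).toIdeal :=
    (Ideal.span_singleton_le_iff_mem _).2
      (HomogeneousIdeal.mem_irrelevant_of_mem 𝒜 one_pos (decompose 𝒜 f 1).2)
  refine ⟨decompose 𝒜 f 1, (decompose 𝒜 f 1).2, le_antisymm (fun r hr => ?_) hle⟩
  -- comparing components of degree one in `r = s f` for `r ∈ R₁`
  have h1 : ∀ r ∈ 𝒜 1, r ∈ Ideal.span {(decompose 𝒜 f 1 : R)} := fun r hr => by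
    obtain ⟨s, hs⟩ := Ideal.mem_span_singleton'.1
      (hf.le (HomogeneousIdeal.mem_irrelevant_of_mem 𝒜 one_pos hr))
    have h := coe_mul_apply_eq_sum_antidiagonal 𝒜 (decompose 𝒜 s) (decompose 𝒜 f) 1
    rw [← decompose_mul, hs, decompose_of_mem_same 𝒜 hr,
      show Finset.HasAntidiagonal.antidiagonal 1 = {(0, 1), (1, 0)} from rfl, Finset.sum_pair (by simp), hf0,
      mul_zero, add_zero] at h
    exact Ideal.mem_span_singleton'.2 ⟨_, h.symm⟩
  have h2 : ∀ r : R, ∃ a ∈ 𝒜 0, r - a ∈ Ideal.span {(decompose 𝒜 f 1 : R)} := fun r => by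
    have hr : r ∈ Algebra.adjoin (𝒜 0) (𝒜 1 : Set R) := hstd ▸ Algebra.mem_top
    induction hr using Algebra.adjoin_induction with
    | mem x hx => exact ⟨0, zero_mem _, by rw [sub_zero]; exact h1 x hx⟩
    | algebraMap a => exact ⟨a, a.2, by simp [show algebraMap (𝒜 0) R a = a from rfl]⟩
    | add x y _ _ hx hy =>
      obtain ⟨a, ha, ha'⟩ := hx
      obtain ⟨b, hb, hb'⟩ := hy
      exact ⟨a + b, add_mem ha hb, by rw [add_sub_add_comm]; exact add_mem ha' hb'⟩
    | mul x y _ _ hx hy =>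
      obtain ⟨a, ha, ha'⟩ := hx
      obtain ⟨b, hb, hb'⟩ := hy
      refine ⟨a * b, by simpa using SetLike.GradedMul.mul_mem ha hb, ?_⟩
      rw [show x * y - a * b = (x - a) * y + a * (y - b) by ring]
      exact add_mem (Ideal.mul_mem_right _ _ ha') (Ideal.mul_mem_left _ _ hb')
  obtain ⟨a, ha, har⟩ := h2 r
  have ha0 : (decompose 𝒜 a 0 : R) = 0 := by
    have := sub_mem hr (hle har)
    rw [sub_sub_cancel] at this
    exact this
  rw [decompose_of_mem_same 𝒜 ha] at ha0
  rwa [ha0, sub_zero] at har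

end GradedModuleCat

theorem mainTheorem12 {R : Type u} [CommRing R] [IsNoetherianRing R]
    (𝒜 : ℕ → AddSubgroup R) [GradedRing 𝒜]
    (hstd : Algebra.adjoin (𝒜 0) (𝒜 1 : Set R) = ⊤) [IsLocalRing (𝒜 0)]
    (M N : GradedModuleCat 𝒜) [Module.Finite R M] [Module.Finite R N]
    (a₀ : Ideal (𝒜 0)) (ha₀ : a₀ ≤ IsLocalRing.maximalIdeal (𝒜 0)) :
    (∀ (y : R) (hy : y ∈ 𝒜 1) (i : ℕ),
      (i : ℕ∞) ≤ GradedModuleCat.finiteLengthDim (HomogeneousIdeal.spanDegOne 𝒜 y hy) M N →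
      ∃ n₀ : ℤ, ∀ n ≤ n₀, Nonempty
        (GradedModuleCat.LocalCohomologyDeg
            (HomogeneousIdeal.spanDegOne 𝒜 y hy ⊔ HomogeneousIdeal.extendGradeZero 𝒜 a₀) i M N n
          ≃ₗ[𝒜 0]
          GradedModuleCat.LocalCohomologyDeg
            (HomogeneousIdeal.spanDegOne 𝒜 y hy ⊔ HomogeneousIdeal.extendGradeZero 𝒜 a₀) i M N n₀))
    ∧
    ((HomogeneousIdeal.irrelevant 𝒜).toIdeal.IsPrincipal →
      CategoryTheory.projectiveDimension (ModuleCat.of R M) < ⊤ →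
      ∀ i : ℕ,
        (i : ℕ∞) ≤ GradedModuleCat.finiteLengthDim (HomogeneousIdeal.irrelevant 𝒜) M N →
        ∃ S : Finset ℤ, ∀ n : ℤ, ∃ m ∈ S, Nonempty
          (GradedModuleCat.LocalCohomologyDeg
              (HomogeneousIdeal.extendGradeZero 𝒜 a₀ ⊔ HomogeneousIdeal.irrelevant 𝒜) i M N n
            ≃ₗ[𝒜 0]
            GradedModuleCat.LocalCohomologyDeg
              (HomogeneousIdeal.extendGradeZero 𝒜 a₀ ⊔ HomogeneousIdeal.irrelevant 𝒜) i M N m)) := by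
  have hb := GradedModuleCat.vanishesAtBot_extendGradeZero a₀
  refine ⟨fun y hy i _ => ?_, fun hprin _ i _ => ?_⟩
  · rw [sup_comm]
    exact GradedModuleCat.exists_nonempty_equiv_of_le hb hy _ rfl M N i
  · obtain ⟨y, hy, hirr⟩ := GradedModuleCat.exists_irrelevant_eq_span hstd hprin
    obtain ⟨n₀, h₀⟩ := GradedModuleCat.exists_nonempty_equiv_of_le hb hy
      (HomogeneousIdeal.irrelevant 𝒜) hirr M N i
    obtain ⟨n₁, h₁⟩ := GradedModuleCat.exists_nonempty_equiv_of_ge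
      (HomogeneousIdeal.extendGradeZero 𝒜 a₀ ⊔ HomogeneousIdeal.irrelevant 𝒜) hy hirr M N i
    -- `n₀` and `n₁` need not be ordered, so they are included separately
    refine ⟨insert n₀ (insert n₁ (Finset.Icc n₀ n₁)), fun n => ?_⟩
    rcases le_or_gt n n₀ with hn | hn
    · exact ⟨n₀, by simp, h₀ n hn⟩
    · rcases le_or_gt n₁ n with hn' | hn'
      · exact ⟨n₁, by simp, h₁ n hn'⟩
      · exact ⟨n, by simp [hn.le, hn'.le], ⟨LinearEquiv.refl _ _⟩⟩
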